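/- For a finite set $\mathcal M$ of positive integers put $$S(\mathcal M):=\sum_{m,n\in\mathcal M}\sqrt{\frac{(m,n)}{[m,n]}},$$ where $(m,n)$ and $[m,n]$ denote the greatest common divisor and the least common multiple of $m$ and $n$. Let $\log_k$ denote the $k$-th iterate of the logarithm, and for $x>16$ put $$\mathcal L(x):=\exp\Big\{\sqrt{\frac{\log x\,\log_3 x}{\log_2 x}}\Big\}.$$ Let $\pi(x)$ be the number of primes $p\le x$ and $\omega(q)$ the number of distinct prime factors of $q$. There is a function $\varepsilon:\mathbb N\to\mathbb R$ with $\varepsilon(N)\to0$ as $N\to\infty$ such that the following holds. Let $q\ge1$ and $N\ge3$ be integers with $\pi(\log N\,\log_2N)\ge\omega(q)$. Then there is a non-empty finite set $\mathcal M_q$ of positive integers such that $$|\mathcal M_q|\le N,\qquad \max\mathcal M_q\le2\min\mathcal M_q,\qquad \Big(\prod_{m\in\mathcal M_q}m,\;q\Big)=1,$$ and, if $N>16$, $$S(\mathcal M_q)\ge|\mathcal M_q|\,\mathcal L(N)^{2\sqrt2+\varepsilon(N)}.$$ -/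

import Mathlib

open Filter Topology

/-- The Gál sum `S(M) = ∑_{m, n ∈ M} √((m, n) / [m, n])` of a finite set of integers. -/
noncomputable def galSum (M : Finset ℕ) : ℝ :=
  ∑ m ∈ M, ∑ n ∈ M, Real.sqrt ((Nat.gcd m n : ℝ) / (Nat.lcm m n : ℝ))

/-- `𝓛(x) = exp √(log x · log₃ x / log₂ x)`, where `log_k` is the `k`-th iterate of the logarithm;
it is used for `x > 16` only, where the three iterated logarithms are positive. -/
noncomputable def galL (x : ℝ) : ℝ :=
  Real.exp (Real.sqrt
    (Real.log x * Real.log (Real.log (Real.log x)) / Real.log (Real.log x)))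

/-- `π(x)`, the number of primes `p ≤ x`, for real `x`. -/
noncomputable def primePi (x : ℝ) : ℕ := Nat.primeCounting ⌊x⌋₊

/-! The kernel is positive semidefinite and factorizes over primes, so a quadratic form with product
amplitudes is a product of one-prime forms. At each prime of a set `P` the exponents 0, 1, 2 get
probabilities w, 1 - 2w, w, and the amplitudes are their square roots. Both outer states are coupled
to the middle one, so a prime multiplies the form by about exp(4 √(w/p)) (`exp_le_sum_rowWeight`),
while its mean information content is about 2w log(1/w) (`sum_entropy_mul_rowWeight_le`).

If the total mean information is slightly below log N, Markov's inequality for the measure tilted by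
the form, followed by Cauchy–Schwarz, lets one keep only configurations of probability at least 1/N
without losing more than a constant factor (`exists_truncated_product`). There are at most N of
these. Sorting them by the dyadic size of the integer and of the amplitude turns the weighted form
into the Gál sum of a set in a dyadic interval; the number of classes is a power of log N, hence
harmless (`exists_dyadic_galSum_ge`).

It remains to optimize. Write l = log log N, y = l exp l, t = log(p/y) and w = α/(p t²). In the
chosen range log(1/w) ≈ t, so with A = ∑ 1/(p t) the information is about 2αA and the exponent of
the form is 4 √α A. Taking 2αA ≈ log N gives 2√2 √(A log N). By Mertens' theorem A ≈ (log l)/l, even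
after removing the primes dividing q: there are at most y of them, and every prime in use is far
beyond y (`eventually_exists_primes`). This gives the exponent 2√2 - O(δ) for each fixed δ and large
N, and a choice of δ depending on N finishes. -/

/-! ### The Gál kernel: multiplicativity and positivity -/

/-- The kernel `√((m, n) / [m, n])` of the Gál sum. -/
noncomputable def galKernel (m n : ℕ) : ℝ := Real.sqrt ((Nat.gcd m n : ℝ) / (Nat.lcm m n : ℝ))

theorem galKernel_nonneg (m n : ℕ) : 0 ≤ galKernel m n := Real.sqrt_nonneg _

theorem galKernel_comm (m n : ℕ) : galKernel m n = galKernel n m := by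
  unfold galKernel; rw [Nat.gcd_comm, Nat.lcm_comm]

theorem galKernel_self {m : ℕ} (hm : 0 < m) : galKernel m m = 1 := by
  have : (m : ℝ) ≠ 0 := by positivity
  simp [galKernel, this]

theorem galKernel_eq {m n : ℕ} (hm : 0 < m) (hn : 0 < n) :
    galKernel m n = (Nat.gcd m n : ℝ) / (Real.sqrt m * Real.sqrt n) := by
  have hg : (0 : ℝ) < Nat.gcd m n := by exact_mod_cast Nat.gcd_pos_of_pos_left n hm
  have hl : (0 : ℝ) < Nat.lcm m n := by exact_mod_cast Nat.lcm_pos hm hn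
  have h : (Nat.gcd m n : ℝ) * Nat.lcm m n = m * n := by exact_mod_cast Nat.gcd_mul_lcm m n
  have hm' : (0 : ℝ) < m := by exact_mod_cast hm
  have hn' : (0 : ℝ) < n := by exact_mod_cast hn
  rw [galKernel, ← Real.sqrt_mul hm'.le, ← h, Real.sqrt_eq_iff_mul_self_eq (by positivity)
    (by positivity), div_mul_div_comm, Real.mul_self_sqrt (by positivity)]
  field_simp

theorem galKernel_mul {a a' b b' : ℕ} (ha : 0 < a) (ha' : 0 < a') (hb : 0 < b) (hb' : 0 < b')
    (h1 : a.Coprime b') (h2 : b.Coprime a') (h3 : a'.Coprime b') :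
    galKernel (a * b) (a' * b') = galKernel a a' * galKernel b b' := by
  rw [galKernel_eq (Nat.mul_pos ha hb) (Nat.mul_pos ha' hb'), galKernel_eq ha ha',
    galKernel_eq hb hb', Nat.Coprime.gcd_mul _ h3, Nat.Coprime.gcd_mul_right_cancel _ h2,
    Nat.Coprime.gcd_mul_left_cancel _ h1]
  push_cast
  rw [Real.sqrt_mul (Nat.cast_nonneg _), Real.sqrt_mul (Nat.cast_nonneg _), div_mul_div_comm]
  congr 1
  ring

/-- The Gál kernel is a Gram matrix on every bounded set of positive integers. -/
theorem exists_galKernel_gram (B : ℕ) :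
    ∃ X : ℕ → ℕ → ℝ, ∀ m n : ℕ, 0 < m → 0 < n → m ≤ B → n ≤ B →
      galKernel m n = ∑ d ∈ Finset.range (B + 1), X d m * X d n := by
  -- The factorization comes from gcd(m, n) = ∑ φ(d) over the common divisors d of m and n.
  refine ⟨fun d m => if d ∣ m then Real.sqrt (Nat.totient d) / Real.sqrt m else 0, ?_⟩
  intro m n hm hn hmB hnB
  have h : (Nat.gcd m n : ℝ) = ∑ d ∈ (Nat.gcd m n).divisors, (Nat.totient d : ℝ) := by
    exact_mod_cast (Nat.sum_totient _).symm
  have hsub : (Nat.gcd m n).divisors = (Finset.range (B + 1)).filter (fun d => d ∣ m ∧ d ∣ n) := by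
    ext d
    simp only [Nat.mem_divisors, Finset.mem_filter, Finset.mem_range, Nat.dvd_gcd_iff]
    constructor
    · rintro ⟨h, -⟩
      exact ⟨by have := Nat.le_of_dvd hm h.1; omega, h⟩
    · rintro ⟨-, h⟩
      exact ⟨h, (Nat.gcd_pos_of_pos_left n hm).ne'⟩
  rw [galKernel_eq hm hn, h, hsub, Finset.sum_filter, Finset.sum_div]
  refine Finset.sum_congr rfl fun d _ => ?_
  by_cases h1 : d ∣ m <;> by_cases h2 : d ∣ n <;> simp [h1, h2]
  rw [div_mul_div_comm, Real.mul_self_sqrt (Nat.cast_nonneg _)]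

/-! ### Weighted forms and dyadic classes -/

section Form
variable {ι : Type*}

/-- The bilinear form attached to the Gál kernel, along a family `m` of integers. -/
noncomputable def galForm (m : ι → ℕ) (c : ι → ℝ) (E F : Finset ι) : ℝ :=
  ∑ i ∈ E, ∑ j ∈ F, c i * c j * galKernel (m i) (m j)

theorem exists_galForm_gram (m : ι → ℕ) (c : ι → ℝ) (E : Finset ι) (hm : ∀ i ∈ E, 0 < m i) :
    ∃ (R : Finset ℕ) (Y : ℕ → ι → ℝ), ∀ F G : Finset ι, F ⊆ E → G ⊆ E →
      galForm m c F G = ∑ d ∈ R, (∑ i ∈ F, Y d i) * ∑ j ∈ G, Y d j := by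
  obtain ⟨X, hX⟩ := exists_galKernel_gram (E.sup m)
  refine ⟨Finset.range (E.sup m + 1), fun d i => c i * X d (m i), fun F G hF hG => ?_⟩
  simp_rw [Finset.sum_mul_sum]
  rw [Finset.sum_comm, galForm]
  refine Finset.sum_congr rfl fun i hi => ?_
  rw [Finset.sum_comm]
  refine Finset.sum_congr rfl fun j hj => ?_
  rw [hX _ _ (hm i (hF hi)) (hm j (hG hj)) (Finset.le_sup (hF hi)) (Finset.le_sup (hG hj)),
    Finset.mul_sum]
  exact Finset.sum_congr rfl fun d _ => by ring

/-- Cauchy–Schwarz for a Gram form: a large mixed form between a subset and the whole forces a large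
diagonal form on the subset. -/
theorem galForm_sq_le (m : ι → ℕ) (c : ι → ℝ) (E F : Finset ι) (hF : F ⊆ E)
    (hm : ∀ i ∈ E, 0 < m i) :
    galForm m c F E ^ 2 ≤ galForm m c F F * galForm m c E E := by
  obtain ⟨R, Y, h⟩ := exists_galForm_gram m c E hm
  rw [h F E hF subset_rfl, h F F hF hF, h E E subset_rfl subset_rfl]
  simp_rw [← sq]
  exact Finset.sum_mul_sq_le_sq_mul_sq _ _ _

/-- In each Gram coordinate, the square of a sum of |C| terms is at most |C| times the sum of their
squares. Off-diagonal class interactions thus cost only the number of classes. -/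
theorem galForm_le_card_mul_sum {κ : Type*} [DecidableEq κ] (m : ι → ℕ) (c : ι → ℝ) (E : Finset ι)
    (hm : ∀ i ∈ E, 0 < m i) (f : ι → κ) (C : Finset κ) (hf : ∀ i ∈ E, f i ∈ C) :
    galForm m c E E ≤
      C.card * ∑ k ∈ C, galForm m c (E.filter (f · = k)) (E.filter (f · = k)) := by
  obtain ⟨R, Y, h⟩ := exists_galForm_gram m c E hm
  rw [h E E subset_rfl subset_rfl,
    Finset.sum_congr rfl fun k _ => h _ _ (Finset.filter_subset (f · = k) E)
      (Finset.filter_subset (f · = k) E), Finset.sum_comm, Finset.mul_sum]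
  refine Finset.sum_le_sum fun d _ => ?_
  simp_rw [← sq]
  rw [← Finset.sum_fiberwise_of_maps_to hf]
  exact sq_sum_le_card_mul_sum_sq

theorem galForm_le_of_le (m : ι → ℕ) (c : ι → ℝ) (E : Finset ι) (hc : ∀ i, 0 ≤ c i)
    (hinj : Set.InjOn m E) {a : ℝ} (ha : ∀ i ∈ E, c i ≤ a) :
    galForm m c E E ≤ a ^ 2 * galSum (E.image m) := by
  have h : galSum (E.image m) = ∑ i ∈ E, ∑ j ∈ E, galKernel (m i) (m j) := by
    unfold galSum
    rw [Finset.sum_image hinj]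
    refine Finset.sum_congr rfl fun i _ => ?_
    rw [Finset.sum_image hinj]
    rfl
  rw [h, Finset.mul_sum, galForm]
  refine Finset.sum_le_sum fun i hi => ?_
  rw [Finset.mul_sum]
  refine Finset.sum_le_sum fun j hj => ?_
  refine mul_le_mul_of_nonneg_right ?_ (galKernel_nonneg _ _)
  rw [sq]
  exact mul_le_mul (ha i hi) (ha j hj) (hc j) ((hc i).trans (ha i hi))

/-- From a weighted form to the Gál sum of a set contained in a dyadic interval. -/
theorem exists_dyadic_galSum_ge (m : ι → ℕ) (c : ι → ℝ) (E : Finset ι) (hm : ∀ i ∈ E, 0 < m i)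
    (hinj : Set.InjOn m E) (hc : ∀ i, 0 < c i) (hc1 : ∀ i ∈ E, c i ≤ 1)
    (hsum : ∑ i ∈ E, c i ^ 2 ≤ 1) {N Y : ℕ} (hcN : ∀ i ∈ E, 1 ≤ N * c i)
    (hY : ∀ i ∈ E, m i ≤ Y) {G : ℝ} (hG : 0 < G) (hGE : G ≤ galForm m c E E) :
    ∃ (M : Finset ℕ) (hM : M.Nonempty), M ⊆ E.image m ∧ M.max' hM ≤ 2 * M.min' hM ∧
      (M.card : ℝ) * (G / (4 * ((Nat.log 2 Y + 1) * (Nat.log 2 N + 1)))) ≤ galSum M := by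
  classical
  set D : ℝ := (Nat.log 2 Y + 1) * (Nat.log 2 N + 1) with hD
  have hDpos : 0 < D := by positivity
  -- The first label puts the integers of a class in a dyadic interval; the second makes the
  -- amplitudes comparable within a factor 2, whose square is the 4 in the bound.
  let f : ι → ℕ × ℕ := fun i => (Nat.log 2 (m i), Nat.log 2 ⌊1 / c i⌋₊)
  let C := Finset.range (Nat.log 2 Y + 1) ×ˢ Finset.range (Nat.log 2 N + 1)
  have hf : ∀ i ∈ E, f i ∈ C := by
    intro i hi
    simp only [C, f, Finset.mem_product, Finset.mem_range, Nat.lt_succ_iff]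
    refine ⟨Nat.log_mono_right (hY i hi), Nat.log_mono_right ?_⟩
    apply Nat.floor_le_of_le
    rw [div_le_iff₀ (hc i)]
    exact hcN i hi
  have hcard : (C.card : ℝ) = D := by simp [C, hD]
  have hlev : ∀ k, ∀ i ∈ E.filter (f · = k), c i ≤ (1 / 2) ^ k.2 ∧ (1 / 2) ^ (k.2 + 1) ≤ c i := by
    intro k i hi
    obtain ⟨hiE, rfl⟩ := Finset.mem_filter.1 hi
    have h1 : 1 ≤ 1 / c i := by rw [le_div_iff₀ (hc i), one_mul]; exact hc1 i hiE
    have hfl : ⌊1 / c i⌋₊ ≠ 0 := (Nat.floor_pos.2 h1).ne'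
    have h2 := Nat.pow_log_le_self 2 hfl
    have h3 := Nat.lt_pow_succ_log_self (b := 2) (by norm_num) ⌊1 / c i⌋₊
    have h4 : ((2 : ℝ) ^ Nat.log 2 ⌊1 / c i⌋₊) ≤ 1 / c i :=
      le_trans (by exact_mod_cast h2) (Nat.floor_le (by positivity))
    have h5 : 1 / c i < (2 : ℝ) ^ (Nat.log 2 ⌊1 / c i⌋₊ + 1) := by
      have := (Nat.floor_lt (by positivity)).1 h3
      exact_mod_cast this
    have hci := hc i
    simp only [f, one_div, inv_pow]
    rw [one_div] at h4 h5
    exact ⟨(le_inv_comm₀ (by positivity) hci).1 h4, (inv_le_comm₀ hci (by positivity)).1 h5.le⟩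
  -- If every dyadic image fell short, each nonempty class would have form below (G/D) ∑ c². Summing
  -- over the D classes would give a total form below G ∑ c² ≤ G.
  by_contra hcon
  push Not at hcon
  have key : ∀ k ∈ C, galForm m c (E.filter (f · = k)) (E.filter (f · = k)) ≤
      (G / D) * ∑ i ∈ E.filter (f · = k), c i ^ 2 ∧ ((E.filter (f · = k)).Nonempty →
      galForm m c (E.filter (f · = k)) (E.filter (f · = k)) <
      (G / D) * ∑ i ∈ E.filter (f · = k), c i ^ 2) := by
    intro k _
    rcases (E.filter (f · = k)).eq_empty_or_nonempty with he | hne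
    · rw [he]; simp [galForm]
    suffices h : galForm m c (E.filter (f · = k)) (E.filter (f · = k)) <
      (G / D) * ∑ i ∈ E.filter (f · = k), c i ^ 2 from ⟨h.le, fun _ => h⟩
    have hsubE := Finset.filter_subset (f · = k) E
    have hinj' : Set.InjOn m (E.filter (f · = k)) := hinj.mono (by exact_mod_cast hsubE)
    have h1 := galForm_le_of_le m c (E.filter (f · = k)) (fun i => (hc i).le) hinj'
      (fun i hi => (hlev k i hi).1)
    have hM : ((E.filter (f · = k)).image m).Nonempty := hne.image m
    have hdy : ((E.filter (f · = k)).image m).max' hM ≤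
        2 * ((E.filter (f · = k)).image m).min' hM := by
      obtain ⟨i, hi, hi'⟩ := Finset.mem_image.1 (Finset.max'_mem _ hM)
      obtain ⟨j, hj, hj'⟩ := Finset.mem_image.1 (Finset.min'_mem _ hM)
      rw [← hi', ← hj']
      obtain ⟨hiE, hik⟩ := Finset.mem_filter.1 hi
      obtain ⟨hjE, hjk⟩ := Finset.mem_filter.1 hj
      have e : Nat.log 2 (m i) = Nat.log 2 (m j) := by
        have := hik.trans hjk.symm
        exact (Prod.ext_iff.1 this).1
      have a1 := Nat.lt_pow_succ_log_self (b := 2) (by norm_num) (m i)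
      have a2 := Nat.pow_log_le_self 2 (hm j hjE).ne'
      rw [e, pow_succ] at a1
      omega
    have h2 := hcon _ hM (Finset.image_subset_image hsubE) hdy
    rw [Finset.card_image_of_injOn hinj'] at h2
    have h3 : ((E.filter (f · = k)).card : ℝ) * ((1 / 2) ^ (k.2 + 1)) ^ 2 ≤
        ∑ i ∈ E.filter (f · = k), c i ^ 2 := by
      rw [← nsmul_eq_mul]
      refine Finset.card_nsmul_le_sum _ _ _ fun i hi => ?_
      exact pow_le_pow_left₀ (by positivity) (hlev k i hi).2 2
    calc _ ≤ _ := h1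
      _ < ((1 / 2) ^ k.2) ^ 2 * (((E.filter (f · = k)).card : ℝ) * (G / (4 * D))) :=
          mul_lt_mul_of_pos_left h2 (by positivity)
      _ = (G / D) * (((E.filter (f · = k)).card : ℝ) * ((1 / 2) ^ (k.2 + 1)) ^ 2) := by
          rw [pow_succ (1 / 2 : ℝ) k.2]; field_simp; ring
      _ ≤ _ := mul_le_mul_of_nonneg_left h3 (by positivity)
  have hEne : E.Nonempty := by
    rw [Finset.nonempty_iff_ne_empty]
    rintro rfl
    simp [galForm] at hGE
    linarith
  obtain ⟨i₀, hi₀⟩ := hEne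
  have hlt : ∑ k ∈ C, galForm m c (E.filter (f · = k)) (E.filter (f · = k)) <
      ∑ k ∈ C, (G / D) * ∑ i ∈ E.filter (f · = k), c i ^ 2 := by
    refine Finset.sum_lt_sum (fun k hk => (key k hk).1) ⟨f i₀, hf i₀ hi₀, (key _ (hf i₀ hi₀)).2 ?_⟩
    exact ⟨i₀, by simp [hi₀]⟩
  rw [← Finset.mul_sum, Finset.sum_fiberwise_of_maps_to hf] at hlt
  have h1 := galForm_le_card_mul_sum m c E hm f C hf
  rw [hcard] at h1
  have h2 : D * ∑ k ∈ C, galForm m c (E.filter (f · = k)) (E.filter (f · = k)) <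
      D * (G / D * ∑ i ∈ E, c i ^ 2) := mul_lt_mul_of_pos_left hlt hDpos
  have h3 : D * (G / D * ∑ i ∈ E, c i ^ 2) = G * ∑ i ∈ E, c i ^ 2 := by field_simp
  nlinarith
end Form

/-! ### Truncation of product weights -/

section Product
variable {ι σ : Type*} [Fintype ι] [DecidableEq ι] [Fintype σ]

/-- This is linearity of expectation for an unnormalized product measure. Replacing the product of
the masses over j ≠ i by the full product only increases it, since every mass is at least 1. -/
theorem sum_mul_prod_le (r h : ι → σ → ℝ) (hr : ∀ i s, 0 ≤ r i s) (hh : ∀ i s, 0 ≤ h i s)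
    (hT : ∀ i, 1 ≤ ∑ s, r i s) :
    ∑ e : ι → σ, (∑ i, h i (e i)) * ∏ i, r i (e i) ≤
      (∏ i, ∑ s, r i s) * ∑ i, ∑ s, h i s * r i s := by
  simp_rw [Finset.sum_mul]
  rw [Finset.sum_comm, Finset.mul_sum]
  refine Finset.sum_le_sum fun i _ => ?_
  have h1 : ∀ e : ι → σ, h i (e i) * ∏ j, r j (e j) =
      ∏ j, (if j = i then h j (e j) else 1) * r j (e j) := by
    intro e
    rw [Finset.prod_mul_distrib, Finset.prod_ite_eq' Finset.univ i]
    simp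
  simp_rw [h1]
  rw [← Fintype.prod_sum (fun j s => (if j = i then h j s else 1) * r j s),
    ← Finset.mul_prod_erase Finset.univ _ (Finset.mem_univ i),
    ← Finset.mul_prod_erase Finset.univ (fun j => ∑ s, r j s) (Finset.mem_univ i)]
  have h2 : ∏ j ∈ Finset.univ.erase i, ∑ s, (if j = i then h j s else 1) * r j s =
      ∏ j ∈ Finset.univ.erase i, ∑ s, r j s := by
    refine Finset.prod_congr rfl fun j hj => ?_
    simp [Finset.ne_of_mem_erase hj]
  rw [h2]
  simp only [if_true]
  have h3 : 0 ≤ ∏ j ∈ Finset.univ.erase i, ∑ s, r j s :=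
    Finset.prod_nonneg fun j _ => zero_le_one.trans (hT j)
  have h4 : 0 ≤ ∑ s, h i s * r i s :=
    Finset.sum_nonneg fun s _ => mul_nonneg (hh i s) (hr i s)
  nlinarith [mul_nonneg (mul_nonneg h4 h3) (sub_nonneg.2 (hT i))]

/-- Markov's inequality for the unnormalized product measure: the part where the cost exceeds Λ
carries at most the proportion 1 - δ. -/
theorem le_sum_prod_filter (r h : ι → σ → ℝ) (hr : ∀ i s, 0 ≤ r i s) (hh : ∀ i s, 0 ≤ h i s)
    (hT : ∀ i, 1 ≤ ∑ s, r i s) {Λ δ : ℝ} (hΛ : 0 < Λ)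
    (hE : ∑ i, ∑ s, h i s * r i s ≤ (1 - δ) * Λ) :
    δ * ∏ i, ∑ s, r i s ≤
      ∑ e ∈ Finset.univ.filter (fun e : ι → σ => ∑ i, h i (e i) ≤ Λ), ∏ i, r i (e i) := by
  have hp : ∀ e : ι → σ, 0 ≤ ∏ i, r i (e i) := fun e => Finset.prod_nonneg fun i _ => hr _ _
  have h1 := sum_mul_prod_le r h hr hh hT
  have h2 : Λ * ∑ e ∈ Finset.univ.filter (fun e : ι → σ => ¬ ∑ i, h i (e i) ≤ Λ),
      ∏ i, r i (e i) ≤ ∑ e : ι → σ, (∑ i, h i (e i)) * ∏ i, r i (e i) := by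
    rw [Finset.mul_sum]
    refine (Finset.sum_le_sum (g := fun e => (∑ i, h i (e i)) * ∏ i, r i (e i)) ?_).trans
      (Finset.sum_le_sum_of_subset_of_nonneg (Finset.filter_subset _ _) ?_)
    · intro e he
      exact mul_le_mul_of_nonneg_right (not_le.1 (Finset.mem_filter.1 he).2).le (hp e)
    · intro e _ _
      exact mul_nonneg (Finset.sum_nonneg fun i _ => hh _ _) (hp e)
  have h3 := Finset.sum_filter_add_sum_filter_not Finset.univ
    (fun e : ι → σ => ∑ i, h i (e i) ≤ Λ) (fun e => ∏ i, r i (e i))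
  rw [← Fintype.prod_sum] at h3
  have hTT : 0 ≤ ∏ i, ∑ s, r i s := Finset.prod_nonneg fun i _ => zero_le_one.trans (hT i)
  have h4 := mul_le_mul_of_nonneg_left hE hTT
  have h5 : ∑ e ∈ Finset.univ.filter (fun e : ι → σ => ¬ ∑ i, h i (e i) ≤ Λ),
      ∏ i, r i (e i) ≤ (1 - δ) * ∏ i, ∑ s, r i s := by
    refine le_of_mul_le_mul_left ?_ hΛ
    nlinarith
  linarith

end Product

/-! ### Product weights on integers with given prime support -/

section PrimePowers
variable {ι : Type*}

theorem galKernel_prod_pow (p : ι → ℕ) (hp : ∀ i, (p i).Prime) (hinj : Function.Injective p)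
    (e e' : ι → ℕ) (s : Finset ι) :
    galKernel (∏ i ∈ s, p i ^ e i) (∏ i ∈ s, p i ^ e' i) =
      ∏ i ∈ s, galKernel (p i ^ e i) (p i ^ e' i) := by
  classical
  induction s using Finset.induction_on with
  | empty => simp [galKernel]
  | insert a s ha ih =>
    have hpos : ∀ (f : ι → ℕ) i, 0 < p i ^ f i := fun f i => pow_pos (hp i).pos _
    have hcop : ∀ (f g : ι → ℕ), (p a ^ f a).Coprime (∏ i ∈ s, p i ^ g i) := by
      intro f g
      refine Nat.Coprime.prod_right fun i hi => ?_
      refine Nat.Coprime.pow _ _ ((Nat.coprime_primes (hp a) (hp i)).2 ?_)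
      intro h
      exact ha (hinj h ▸ hi)
    rw [Finset.prod_insert ha, Finset.prod_insert ha, Finset.prod_insert ha, ← ih]
    exact galKernel_mul (hpos _ _) (hpos _ _) (Finset.prod_pos fun i _ => hpos _ _)
      (Finset.prod_pos fun i _ => hpos _ _) (hcop _ _) (hcop _ _).symm (hcop _ _)

theorem factorization_prod_pow_apply [Fintype ι] (p : ι → ℕ) (hp : ∀ i, (p i).Prime)
    (hinj : Function.Injective p) (e : ι → ℕ) (i : ι) :
    (∏ j, p j ^ e j).factorization (p i) = e i := by
  classical
  rw [Nat.factorization_prod fun j _ => (pow_pos (hp j).pos _).ne', Finsupp.finsetSum_apply]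
  rw [Finset.sum_eq_single i]
  · simp [(hp i).factorization_self]
  · intro j _ hj
    rw [(hp j).factorization_pow, Finsupp.single_eq_of_ne]
    exact fun h => hj (hinj h.symm)
  · simp

variable [Fintype ι] {k : ℕ}

/-- The integer `∏ p i ^ e i`. -/
def primeProd (p : ι → ℕ) (e : ι → Fin k) : ℕ := ∏ i, p i ^ (e i : ℕ)

theorem primeProd_pos (p : ι → ℕ) (hp : ∀ i, (p i).Prime) (e : ι → Fin k) : 0 < primeProd p e :=
  Finset.prod_pos fun i _ => pow_pos (hp i).pos _

theorem primeProd_injective (p : ι → ℕ) (hp : ∀ i, (p i).Prime) (hinj : Function.Injective p) :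
    Function.Injective (primeProd p : (ι → Fin k) → ℕ) := by
  intro e e' h
  funext i
  have h1 := factorization_prod_pow_apply p hp hinj (fun i => (e i : ℕ)) i
  have h2 := factorization_prod_pow_apply p hp hinj (fun i => (e' i : ℕ)) i
  unfold primeProd at h
  rw [h] at h1
  exact Fin.ext (h1.symm.trans h2)

variable [DecidableEq ι]

/-- The total weight of the state `s` in a one-prime form. -/
noncomputable def rowWeight (p : ℕ) (c : Fin k → ℝ) (s : Fin k) : ℝ :=
  ∑ s', c s * c s' * galKernel (p ^ (s : ℕ)) (p ^ (s' : ℕ))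

/-- A product weight, restricted to the configurations of weight at least `exp (-Λ)`, still carries
a positive proportion of the full form. -/
theorem exists_truncated_product (p : ι → ℕ) (hp : ∀ i, (p i).Prime) (hinj : Function.Injective p)
    (c : ι → Fin k → ℝ) (hc : ∀ i s, 0 < c i s) (hc1 : ∀ i, ∑ s, c i s ^ 2 = 1)
    {Λ δ : ℝ} (hΛ : 0 < Λ) (hδ : 0 < δ)
    (hE : ∑ i, ∑ s, (-Real.log (c i s ^ 2)) * rowWeight (p i) (c i) s ≤ (1 - δ) * Λ) :
    ∃ E : Finset (ι → Fin k), (∀ e ∈ E, Real.exp (-Λ) ≤ (∏ i, c i (e i)) ^ 2) ∧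
      δ ^ 2 * ∏ i, ∑ s, rowWeight (p i) (c i) s ≤
        galForm (primeProd p) (fun e => ∏ i, c i (e i)) E E := by
  have hle : ∀ i s, c i s ^ 2 ≤ 1 := fun i s =>
    (Finset.single_le_sum (f := fun s => c i s ^ 2) (fun s _ => sq_nonneg _)
      (Finset.mem_univ s)).trans (hc1 i).le
  have hh : ∀ i s, 0 ≤ -Real.log (c i s ^ 2) := fun i s =>
    neg_nonneg.2 (Real.log_nonpos (sq_nonneg _) (hle i s))
  have hr : ∀ i s, 0 ≤ rowWeight (p i) (c i) s := fun i s =>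
    Finset.sum_nonneg fun s' _ => mul_nonneg (mul_nonneg (hc _ _).le (hc _ _).le)
      (galKernel_nonneg _ _)
  have hrow : ∀ i s, c i s ^ 2 ≤ rowWeight (p i) (c i) s := by
    intro i s
    have := Finset.single_le_sum (f := fun s' => c i s * c i s' *
      galKernel (p i ^ (s : ℕ)) (p i ^ (s' : ℕ))) (fun s' _ => mul_nonneg
        (mul_nonneg (hc _ _).le (hc _ _).le) (galKernel_nonneg _ _)) (Finset.mem_univ s)
    simp only [galKernel_self (pow_pos (hp i).pos _)] at this
    unfold rowWeight
    linarith
  have hT : ∀ i, 1 ≤ ∑ s, rowWeight (p i) (c i) s := fun i =>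
    (hc1 i).symm.le.trans (Finset.sum_le_sum fun s _ => hrow i s)
  have key := le_sum_prod_filter _ _ hr hh hT hΛ hE
  set E := Finset.univ.filter (fun e : ι → Fin k => ∑ i, -Real.log (c i (e i) ^ 2) ≤ Λ) with hEdef
  have hform : ∀ F : Finset (ι → Fin k), galForm (primeProd p) (fun e => ∏ i, c i (e i)) F
      Finset.univ = ∑ e ∈ F, ∏ i, rowWeight (p i) (c i) (e i) := by
    intro F
    refine Finset.sum_congr rfl fun e _ => ?_
    unfold rowWeight
    rw [Fintype.prod_sum]
    refine Finset.sum_congr rfl fun e' _ => ?_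
    rw [Finset.prod_mul_distrib, Finset.prod_mul_distrib]
    congr 1
    exact galKernel_prod_pow p hp hinj _ _ _
  refine ⟨E, fun e he => ?_, ?_⟩
  · have h1 := (Finset.mem_filter.1 he).2
    rw [← Finset.prod_pow, ← Real.exp_log (Finset.prod_pos fun i _ => pow_pos (hc i (e i)) 2)]
    rw [Real.exp_le_exp, Real.log_prod fun i _ => (pow_pos (hc i (e i)) 2).ne']
    rw [Finset.sum_neg_distrib] at h1
    linarith
  -- The row weights are nonnegative, so Markov bounds the mixed form of `E` against all
  -- configurations by δ times the full form from below. Cauchy–Schwarz then loses one more δ.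
  · have hcs := galForm_sq_le (primeProd p) (fun e => ∏ i, c i (e i)) Finset.univ E
      (Finset.subset_univ _) (fun e _ => primeProd_pos p hp e)
    have hfull := hform Finset.univ
    rw [← Fintype.prod_sum] at hfull
    rw [hfull, hform E] at hcs
    have hPpos : 0 < ∏ i, ∑ s, rowWeight (p i) (c i) s :=
      Finset.prod_pos fun i _ => zero_lt_one.trans_le (hT i)
    refine le_of_mul_le_mul_right (le_trans ?_ hcs) hPpos
    have := pow_le_pow_left₀ (by positivity) key 2
    linarith [this]

end PrimePowers

/-! ### Mertens' first theorem -/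

/-- `∑ (log p) / p` over the primes `p ≤ n`. -/
noncomputable def mertensSum (n : ℕ) : ℝ := ∑ p ∈ Nat.primesLE n, Real.log p / p

theorem log_factorial_eq_sum_primesLE (n : ℕ) : Real.log n.factorial =
    ∑ p ∈ Nat.primesLE n, (n.factorial.factorization p : ℝ) * Real.log p := by
  rw [Real.log_nat_eq_sum_factorization, Finsupp.sum, Nat.support_factorization]
  refine Finset.sum_congr ?_ fun _ _ => rfl
  ext p
  rw [Nat.mem_primeFactors, Nat.mem_primesLE]
  constructor
  · rintro ⟨h, h1, -⟩; exact ⟨(h.dvd_factorial).1 h1, h⟩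
  · rintro ⟨h, h1⟩; exact ⟨h1, h1.dvd_factorial.2 h, n.factorial_ne_zero⟩

/-- Compare with log n! ≤ n log n: the exponent of p in n! exceeds n/p - 1, and the accumulated -1
costs Chebyshev's θ(n) ≤ n log 4. -/
theorem mertensSum_le {n : ℕ} (hn : 0 < n) : mertensSum n ≤ Real.log n + Real.log 4 := by
  have hn' : (0 : ℝ) < n := by exact_mod_cast hn
  have h1 : Real.log n.factorial ≤ n * Real.log n := by
    rw [← Real.log_pow]
    exact Real.log_le_log (by positivity) (by exact_mod_cast Nat.factorial_le_pow n)
  have h2 : n * mertensSum n ≤ Real.log n.factorial + Chebyshev.theta n := by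
    rw [log_factorial_eq_sum_primesLE, Chebyshev.theta_eq_sum_primesLE_log,
      ← Finset.sum_add_distrib, mertensSum, Finset.mul_sum]
    refine Finset.sum_le_sum fun p hp => ?_
    have hpp := (Nat.mem_primesLE.1 hp).2
    have hv : n / p ≤ n.factorial.factorization p := by
      rw [← hpp.pow_dvd_iff_le_factorization n.factorial_ne_zero]
      rw [hpp.pow_dvd_factorial_iff (b := Nat.log p n + 2) (by omega)]
      have : n / p ^ 1 ≤ ∑ i ∈ Finset.Ico 1 (Nat.log p n + 2), n / p ^ i :=
        Finset.single_le_sum (f := fun i => n / p ^ i) (fun _ _ => Nat.zero_le _) (by simp)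
      simpa using this
    have hlt : (n : ℝ) / p ≤ n.factorial.factorization p + 1 := by
      have h3 : (n : ℝ) / p < ((n / p : ℕ) : ℝ) + 1 := by
        rw [← Nat.floor_div_eq_div (K := ℝ)]; exact Nat.lt_floor_add_one _
      have h4 : ((n / p : ℕ) : ℝ) ≤ n.factorial.factorization p := by exact_mod_cast hv
      linarith
    have hlog : 0 ≤ Real.log p := Real.log_natCast_nonneg p
    calc (n : ℝ) * (Real.log p / p) = n / p * Real.log p := by ring
      _ ≤ (n.factorial.factorization p + 1) * Real.log p := mul_le_mul_of_nonneg_right hlt hlog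
      _ = _ := by ring
  have h3 := Chebyshev.theta_le_log4_mul_x hn'.le
  refine le_of_mul_le_mul_left ?_ hn'
  linarith

/-- Stirling gives log n! ≥ n log n - n, while the exponent of p in n! is at most n/(p - 1). The
excess over n/p contributes log p / (p(p - 1)), summable because log p ≤ 2√p. -/
theorem exists_le_mertensSum : ∃ C : ℝ, ∀ n : ℕ, 0 < n → Real.log n - C ≤ mertensSum n := by
  have hs : Summable fun n : ℕ => 4 * (1 / (n : ℝ) ^ (3 / 2 : ℝ)) :=
    (Real.summable_one_div_nat_rpow.2 (by norm_num)).mul_left 4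
  refine ⟨1 + ∑' n : ℕ, 4 * (1 / (n : ℝ) ^ (3 / 2 : ℝ)), fun n hn => ?_⟩
  have hn' : (0 : ℝ) < n := by exact_mod_cast hn
  have h1 : n * Real.log n - n ≤ Real.log n.factorial := by
    have := Stirling.le_log_factorial_stirling hn.ne'
    have h2 : 0 ≤ Real.log n := Real.log_natCast_nonneg n
    have h3 : 0 ≤ Real.log (2 * Real.pi) := Real.log_nonneg (by linarith [Real.pi_gt_three])
    linarith
  have h2 : Real.log n.factorial ≤
      n * (mertensSum n + ∑ p ∈ Nat.primesLE n, 4 * (1 / (p : ℝ) ^ (3 / 2 : ℝ))) := by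
    rw [log_factorial_eq_sum_primesLE, mertensSum, ← Finset.sum_add_distrib, Finset.mul_sum]
    refine Finset.sum_le_sum fun p hp => ?_
    have hpp := (Nat.mem_primesLE.1 hp).2
    have hp2 : (2 : ℝ) ≤ p := by exact_mod_cast hpp.two_le
    have hv : (n.factorial.factorization p : ℝ) ≤ n / (p - 1) := by
      have h3 : ((n.factorial.factorization p : ℕ) : ℝ) ≤ ((n / (p - 1) : ℕ) : ℝ) := by
        exact_mod_cast Nat.factorization_factorial_le_div_pred hpp n
      refine h3.trans (Nat.cast_div_le.trans ?_)
      rw [Nat.cast_sub hpp.one_lt.le, Nat.cast_one]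
    have hlog : 0 ≤ Real.log p := Real.log_natCast_nonneg p
    have hsq : Real.log p ≤ 2 * Real.sqrt p := by
      have h4 : Real.log (Real.sqrt p) ≤ Real.sqrt p :=
        (Real.log_le_sub_one_of_pos (by positivity)).trans (by linarith)
      rw [Real.log_sqrt (by positivity)] at h4
      linarith
    have hpw : (p : ℝ) ^ (3 / 2 : ℝ) = p * Real.sqrt p := by
      rw [Real.sqrt_eq_rpow, show (3 / 2 : ℝ) = 1 + 1 / 2 by norm_num,
        Real.rpow_add (by positivity), Real.rpow_one]
    have hss : Real.sqrt p * Real.sqrt p = p := Real.mul_self_sqrt (by positivity)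
    have hs0 : 0 < Real.sqrt p := by positivity
    have h5 : Real.log p / (p * (p - 1)) ≤ 4 * (1 / (p * Real.sqrt p)) := by
      rw [mul_one_div, div_le_div_iff₀ (mul_pos (by linarith) (by linarith)) (by positivity)]
      have h6 : Real.log p * Real.sqrt p ≤ 4 * (p - 1) := by nlinarith
      nlinarith
    calc (n.factorial.factorization p : ℝ) * Real.log p ≤ n / (p - 1) * Real.log p :=
          mul_le_mul_of_nonneg_right hv hlog
      _ = n * (Real.log p / p + Real.log p / (p * (p - 1))) := by
          have : (p : ℝ) - 1 ≠ 0 := by linarith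
          field_simp
          ring
      _ ≤ _ := by
          rw [hpw]
          exact mul_le_mul_of_nonneg_left (by linarith) hn'.le
  have h3 : ∑ p ∈ Nat.primesLE n, 4 * (1 / (p : ℝ) ^ (3 / 2 : ℝ)) ≤
      ∑' n : ℕ, 4 * (1 / (n : ℝ) ^ (3 / 2 : ℝ)) :=
    hs.sum_le_tsum _ fun i _ => by positivity
  have h4 := h1.trans (h2.trans (mul_le_mul_of_nonneg_left (add_le_add_right h3 _) hn'.le))
  have h5 : (n : ℝ) * (Real.log n - 1) ≤ n * (mertensSum n +
      ∑' n : ℕ, 4 * (1 / (n : ℝ) ^ (3 / 2 : ℝ))) := by linarith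
  have := le_of_mul_le_mul_left h5 hn'
  linarith

/-- Mertens' first theorem, as a lower bound for the sum over an interval. -/
theorem exists_le_sum_log_div_prime : ∃ C : ℝ, 0 < C ∧ ∀ a b : ℝ, 1 ≤ a → a ≤ b →
    Real.log (b / a) - C ≤
      ∑ p ∈ (Finset.Ioc ⌊a⌋₊ ⌊b⌋₊).filter Nat.Prime, Real.log p / p := by
  obtain ⟨C, hC⟩ := exists_le_mertensSum
  refine ⟨|C| + Real.log 4 + Real.log 2, by positivity, fun a b ha hab => ?_⟩
  have hb : 1 ≤ b := ha.trans hab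
  have hfa : 0 < ⌊a⌋₊ := Nat.floor_pos.2 ha
  have hfb : 0 < ⌊b⌋₊ := Nat.floor_pos.2 hb
  have hle : ⌊a⌋₊ ≤ ⌊b⌋₊ := Nat.floor_le_floor hab
  have hsplit : mertensSum ⌊b⌋₊ = mertensSum ⌊a⌋₊ +
      ∑ p ∈ (Finset.Ioc ⌊a⌋₊ ⌊b⌋₊).filter Nat.Prime, Real.log p / p := by
    unfold mertensSum
    rw [← Finset.sum_union]
    · refine Finset.sum_congr ?_ fun _ _ => rfl
      ext p
      simp only [Nat.mem_primesLE, Finset.mem_union, Finset.mem_filter, Finset.mem_Ioc]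
      by_cases hp : p.Prime <;> simp [hp]
      omega
    · rw [Finset.disjoint_left]
      intro p h1 h2
      simp only [Nat.mem_primesLE, Finset.mem_filter, Finset.mem_Ioc] at h1 h2
      omega
  have h1 := hC _ hfb
  have h2 := mertensSum_le hfa
  have h3 : Real.log ⌊a⌋₊ ≤ Real.log a :=
    Real.log_le_log (by exact_mod_cast hfa) (Nat.floor_le (by linarith))
  have h4 : Real.log b - Real.log 2 ≤ Real.log ⌊b⌋₊ := by
    rw [← Real.log_div (by positivity) (by norm_num)]
    refine Real.log_le_log (by positivity) ?_
    have h5 := Nat.lt_floor_add_one b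
    have h6 : (1 : ℝ) ≤ ⌊b⌋₊ := by exact_mod_cast hfb
    linarith
  rw [Real.log_div (by positivity) (by positivity)]
  linarith [le_abs_self C]

/-! ### The one-prime form with three states -/

/-- The three-state amplitudes with probabilities `w`, `1 - 2 * w`, `w`. -/
noncomputable def triWeight (w : ℝ) : Fin 3 → ℝ :=
  ![Real.sqrt w, Real.sqrt (1 - 2 * w), Real.sqrt w]

theorem triWeight_pos {w : ℝ} (h0 : 0 < w) (h1 : w < 1 / 2) (s : Fin 3) : 0 < triWeight w s := by
  have : 0 < 1 - 2 * w := by linarith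
  fin_cases s <;> simp [triWeight] <;> linarith

theorem sum_triWeight_sq {w : ℝ} (h0 : 0 < w) (h1 : w < 1 / 2) : ∑ s, triWeight w s ^ 2 = 1 := by
  simp only [Fin.sum_univ_three, triWeight, Matrix.cons_val_zero, Matrix.cons_val_one,
    Matrix.cons_val]
  rw [Real.sq_sqrt h0.le, Real.sq_sqrt (by linarith)]
  ring

theorem galKernel_pow_add {p : ℕ} (hp : 0 < p) (a d : ℕ) :
    galKernel (p ^ a) (p ^ (a + d)) = (1 / Real.sqrt p) ^ d := by
  have hp' : (0 : ℝ) < p := by exact_mod_cast hp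
  have h : p ^ a ∣ p ^ (a + d) := pow_dvd_pow _ (Nat.le_add_right _ _)
  rw [galKernel, Nat.gcd_eq_left h, Nat.lcm_eq_right h, Real.sqrt_eq_iff_mul_self_eq (by positivity)
    (by positivity), ← mul_pow, div_mul_div_comm, Real.mul_self_sqrt hp'.le]
  push_cast
  rw [pow_add, mul_one, one_div_pow]
  field_simp

section Local
variable {p : ℕ} {w : ℝ}

theorem rowWeight_zero (hp : 0 < p) (h0 : 0 < w) : rowWeight p (triWeight w) 0 =
    w + Real.sqrt w * Real.sqrt (1 - 2 * w) * (1 / Real.sqrt p) + w * (1 / Real.sqrt p) ^ 2 := by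
  have k0 := galKernel_pow_add hp 0 0
  have k1 := galKernel_pow_add hp 0 1
  have k2 := galKernel_pow_add hp 0 2
  simp only [zero_add, pow_zero, pow_one] at k0 k1 k2
  simp only [rowWeight, Fin.sum_univ_three, triWeight, Matrix.cons_val_zero, Matrix.cons_val_one,
    Matrix.cons_val, Fin.val_zero, Fin.val_one, Fin.val_two, pow_zero, pow_one, k0, k1, k2]
  rw [Real.mul_self_sqrt h0.le]
  ring

theorem rowWeight_one (hp : 0 < p) (h1 : w < 1 / 2) : rowWeight p (triWeight w) 1 =
    1 - 2 * w + 2 * (Real.sqrt w * Real.sqrt (1 - 2 * w) * (1 / Real.sqrt p)) := by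
  have k0 := galKernel_pow_add hp 1 0
  have k1 := galKernel_pow_add hp 0 1
  have k2 := galKernel_pow_add hp 1 1
  rw [galKernel_comm] at k1
  simp only [zero_add, add_zero, pow_zero, pow_one, Nat.reduceAdd] at k0 k1 k2
  simp only [rowWeight, Fin.sum_univ_three, triWeight, Matrix.cons_val_zero, Matrix.cons_val_one,
    Matrix.cons_val, Fin.val_zero, Fin.val_one, Fin.val_two, pow_zero, pow_one, k0, k1, k2]
  rw [Real.mul_self_sqrt (by linarith)]
  ring

theorem rowWeight_two (hp : 0 < p) (h0 : 0 < w) : rowWeight p (triWeight w) 2 =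
    w + Real.sqrt w * Real.sqrt (1 - 2 * w) * (1 / Real.sqrt p) + w * (1 / Real.sqrt p) ^ 2 := by
  have k0 := galKernel_pow_add hp 2 0
  have k1 := galKernel_pow_add hp 1 1
  have k2 := galKernel_pow_add hp 0 2
  rw [galKernel_comm] at k1 k2
  simp only [zero_add, add_zero, pow_zero, pow_one, Nat.reduceAdd] at k0 k1 k2
  simp only [rowWeight, Fin.sum_univ_three, triWeight, Matrix.cons_val_zero, Matrix.cons_val_one,
    Matrix.cons_val, Fin.val_zero, Fin.val_one, Fin.val_two, pow_zero, pow_one, k0, k1, k2]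
  rw [Real.mul_self_sqrt h0.le]
  ring

/-- The one-prime contribution to the logarithm of the form. -/
theorem exp_le_sum_rowWeight (hp : 0 < p) {δ : ℝ} (h0 : 0 < w) (hδ : 0 < δ) (hδ1 : δ ≤ 1 / 2)
    (hw : w ≤ δ / 4) (hx : 1 / Real.sqrt p ≤ δ * Real.sqrt w) :
    Real.exp (4 * (1 - δ) ^ 2 * (Real.sqrt w * (1 / Real.sqrt p))) ≤
      ∑ s, rowWeight p (triWeight w) s := by
  have hp' : (0 : ℝ) < p := by exact_mod_cast hp
  rw [Fin.sum_univ_three, rowWeight_zero hp h0, rowWeight_one hp (by linarith), rowWeight_two hp h0]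
  set u := Real.sqrt w with hu
  set v := Real.sqrt (1 - 2 * w) with hv
  set x := 1 / Real.sqrt p with hxd
  have hu0 : 0 < u := Real.sqrt_pos.2 h0
  have hx0 : 0 < x := by positivity
  have huu : u * u = w := Real.mul_self_sqrt h0.le
  have hvv : v * v = 1 - 2 * w := Real.mul_self_sqrt (by linarith)
  have hv0 : 0 ≤ v := Real.sqrt_nonneg _
  have hv1 : v ≤ 1 := by nlinarith
  have hv2 : 1 - δ ≤ v := by nlinarith
  have hux : u * x ≤ δ * w := by nlinarith
  set z := 4 * (u * v * x) with hz
  have huxp : 0 < u * x := by positivity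
  have hz0 : 0 ≤ z := by positivity
  have hzv : z = 4 * (u * x) * v := by rw [hz]; ring
  have hzδ : z ≤ δ := by
    have : u * x * v ≤ u * x := by nlinarith
    nlinarith
  have hzlow : 4 * (1 - δ) * (u * x) ≤ z := by nlinarith
  have hlog : z * (1 - δ) ≤ Real.log (1 + z) := by
    refine le_trans ?_ (Real.one_sub_inv_le_log_of_pos (by linarith))
    have : 1 - (1 + z)⁻¹ = z / (1 + z) := by field_simp; ring
    rw [this, le_div_iff₀ (by linarith)]
    nlinarith [mul_nonneg hz0 (by linarith : 0 ≤ δ - z), mul_nonneg (mul_nonneg hz0 hz0) hδ.le]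
  have h1 : Real.exp (4 * (1 - δ) ^ 2 * (u * x)) ≤ 1 + z := by
    rw [← Real.le_log_iff_exp_le (by linarith)]
    refine le_trans ?_ hlog
    nlinarith
  refine h1.trans ?_
  have : 0 ≤ w * x ^ 2 := by positivity
  linarith

/-- The one-prime contribution to the mean of the entropy. -/
theorem sum_entropy_mul_rowWeight_le (hp : 0 < p) {δ t : ℝ} (h0 : 0 < w) (hδ : 0 < δ)
    (hδ1 : δ ≤ 1 / 2) (hw : w ≤ δ / 4) (hx : 1 / Real.sqrt p ≤ δ * Real.sqrt w) (ht : 6 ≤ δ * t)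
    (hwt : -Real.log w ≤ (1 + δ) * t) :
    ∑ s, (-Real.log (triWeight w s ^ 2)) * rowWeight p (triWeight w) s ≤
      2 * (1 + 5 * δ) * (w * t) := by
  have hp' : (0 : ℝ) < p := by exact_mod_cast hp
  rw [Fin.sum_univ_three, rowWeight_zero hp h0, rowWeight_one hp (by linarith), rowWeight_two hp h0]
  simp only [triWeight, Matrix.cons_val_zero, Matrix.cons_val_one, Matrix.cons_val]
  rw [Real.sq_sqrt h0.le, Real.sq_sqrt (by linarith : 0 ≤ 1 - 2 * w)]
  set u := Real.sqrt w with hu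
  set v := Real.sqrt (1 - 2 * w) with hv
  set x := 1 / Real.sqrt p with hxd
  have hu0 : 0 < u := Real.sqrt_pos.2 h0
  have hx0 : 0 < x := by positivity
  have huu : u * u = w := Real.mul_self_sqrt h0.le
  have hvv : v * v = 1 - 2 * w := Real.mul_self_sqrt (by linarith)
  have hv0 : 0 ≤ v := Real.sqrt_nonneg _
  have hv1 : v ≤ 1 := by nlinarith
  have hux : u * x ≤ δ * w := by nlinarith
  have huxp : 0 < u * x := by positivity
  have huvx : u * v * x ≤ δ * w := by
    have : u * x * v ≤ u * x := by nlinarith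
    nlinarith
  have huvx0 : 0 ≤ u * v * x := by positivity
  have hx2 : x ^ 2 ≤ δ := by
    have h1 : x ^ 2 ≤ (δ * u) ^ 2 := pow_le_pow_left₀ hx0.le hx 2
    have h2 : (δ * u) ^ 2 = δ * (δ * w) := by rw [← huu]; ring
    have h3 : δ * w ≤ 1 := by nlinarith
    nlinarith
  have hlog : -Real.log (1 - 2 * w) ≤ 4 * w := by
    have h1 := Real.one_sub_inv_le_log_of_pos (by linarith : 0 < 1 - 2 * w)
    have h2 : (1 - 2 * w)⁻¹ ≤ 1 + 4 * w := by
      rw [inv_le_iff_one_le_mul₀ (by linarith)]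
      nlinarith
    linarith
  have hlog0 : 0 ≤ -Real.log (1 - 2 * w) :=
    neg_nonneg.2 (Real.log_nonpos (by linarith) (by linarith))
  have hlogw : 0 ≤ -Real.log w := neg_nonneg.2 (Real.log_nonpos h0.le (by linarith))
  have ht0 : 0 < t := by nlinarith
  have hwt0 : 0 < w * t := by positivity
  have hrow : w + u * v * x + w * x ^ 2 ≤ (1 + 2 * δ) * w := by
    linarith [mul_le_mul_of_nonneg_left hx2 h0.le]
  have a1 : -Real.log w * (w + u * v * x + w * x ^ 2) ≤ (1 + δ) * t * ((1 + 2 * δ) * w) :=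
    mul_le_mul hwt hrow (by positivity) (by positivity)
  have hδw : δ * w ≤ 1 := by nlinarith
  -- The middle state has information O(w), which is negligible against w t since δ t ≥ 6; the two
  -- outer states give the main term 2w t.
  have a2 : -Real.log (1 - 2 * w) * (1 - 2 * w + 2 * (u * v * x)) ≤ 4 * w * 3 :=
    mul_le_mul hlog (by linarith) (by linarith) (by linarith)
  have a3 : 12 * w ≤ 2 * δ * (w * t) := by linarith [mul_le_mul_of_nonneg_left ht h0.le]
  have a4 : (δ * δ) * (w * t) ≤ δ / 2 * (w * t) :=
    mul_le_mul_of_nonneg_right (by nlinarith) hwt0.le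
  have a5 : (1 + δ) * t * ((1 + 2 * δ) * w) = w * t + 3 * (δ * (w * t)) +
    2 * ((δ * δ) * (w * t)) := by ring
  linarith
end Local

/-! ### From a set of primes to a Gál sum -/

/-- A crude bound suffices: only its logarithm enters, through the number of dyadic intervals. -/
theorem primeProd_le {ι : Type*} [Fintype ι] (p : ι → ℕ) {X : ℕ} (hX : ∀ i, p i ≤ X) (hX1 : 1 ≤ X)
    (hcard : Fintype.card ι ≤ X) (e : ι → Fin 3) : primeProd p e ≤ 2 ^ (2 * X ^ 2) := by
  calc primeProd p e ≤ ∏ _i : ι, X ^ 2 := by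
        refine Finset.prod_le_prod' fun i _ => ?_
        exact (Nat.pow_le_pow_left (hX i) _).trans (Nat.pow_le_pow_right hX1 (by omega))
    _ = X ^ (2 * Fintype.card ι) := by rw [Finset.prod_const, Finset.card_univ, ← pow_mul]
    _ ≤ X ^ (2 * X) := Nat.pow_le_pow_right hX1 (by omega)
    _ ≤ (2 ^ X) ^ (2 * X) := Nat.pow_le_pow_left Nat.lt_two_pow_self.le _
    _ = 2 ^ (2 * X ^ 2) := by rw [← pow_mul]; ring_nf

/-- The Gál sum obtained from a finite set `P` of primes with probabilities `α / (p * t p ^ 2)`. -/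
theorem exists_galSum_ge (P : Finset ℕ) (t : ℕ → ℝ) {q N X : ℕ} {α δ : ℝ} (hN : 2 ≤ N)
    (hδ : 0 < δ) (hδ1 : δ ≤ 1 / 2) (hα : 0 < α) (hP : ∀ p ∈ P, p.Prime) (hPq : ∀ p ∈ P, ¬ p ∣ q)
    (hX : ∀ p ∈ P, p ≤ X) (hX1 : 1 ≤ X) (ht : ∀ p ∈ P, 6 ≤ δ * t p)
    (hw : ∀ p ∈ P, α / (p * t p ^ 2) ≤ δ / 4)
    (hwt : ∀ p ∈ P, -Real.log (α / (p * t p ^ 2)) ≤ (1 + δ) * t p)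
    (htα : ∀ p ∈ P, t p ^ 2 ≤ δ ^ 2 * α)
    (hA : 2 * (1 + 5 * δ) * (α * ∑ p ∈ P, 1 / (p * t p)) ≤ (1 - δ) * Real.log N) :
    ∃ (M : Finset ℕ) (hM : M.Nonempty), (∀ m ∈ M, 0 < m) ∧ M.card ≤ N ∧
      M.max' hM ≤ 2 * M.min' hM ∧ Nat.Coprime (∏ m ∈ M, m) q ∧
      (M.card : ℝ) * (δ ^ 2 * Real.exp (4 * (1 - δ) ^ 2 *
        (Real.sqrt α * ∑ p ∈ P, 1 / (p * t p))) /
          (4 * ((2 * X ^ 2 + 1) * (Nat.log 2 N + 1)))) ≤ galSum M := by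
  classical
  have hN0 : (0 : ℝ) < N := by positivity
  let pr : P → ℕ := fun i => i
  let w : P → ℝ := fun i => α / (pr i * t (pr i) ^ 2)
  have hpr : ∀ i, (pr i).Prime := fun i => hP _ i.2
  have hinj : Function.Injective pr := Subtype.val_injective
  have hpp : ∀ i, (0 : ℝ) < pr i := fun i => by exact_mod_cast (hpr i).pos
  have ht0 : ∀ i, 0 < t (pr i) := fun i => by
    have := ht _ i.2
    by_contra h
    have : δ * t (pr i) ≤ 0 := mul_nonpos_of_nonneg_of_nonpos hδ.le (not_lt.1 h)
    have h2 : (6 : ℝ) ≤ δ * t (pr i) := ht _ i.2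
    linarith
  have hw0 : ∀ i, 0 < w i := fun i => by
    have := hpp i; have := ht0 i
    positivity
  have hwδ : ∀ i, w i ≤ δ / 4 := fun i => hw _ i.2
  have hw2 : ∀ i, w i < 1 / 2 := fun i => by linarith [hwδ i]
  have hsw : ∀ i, Real.sqrt (w i) = Real.sqrt α / (Real.sqrt (pr i) * t (pr i)) := fun i => by
    rw [Real.sqrt_div hα.le, Real.sqrt_mul (hpp i).le, Real.sqrt_sq (ht0 i).le]
  have hx : ∀ i, 1 / Real.sqrt (pr i) ≤ δ * Real.sqrt (w i) := fun i => by
    have h1 : t (pr i) ≤ δ * Real.sqrt α := by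
      have := Real.sqrt_le_sqrt (htα _ i.2)
      rwa [Real.sqrt_sq (ht0 i).le, Real.sqrt_mul (by positivity), Real.sqrt_sq hδ.le] at this
    have h2 : 0 < Real.sqrt (pr i) := Real.sqrt_pos.2 (hpp i)
    have h3 := ht0 i
    rw [hsw, mul_div_assoc', div_le_div_iff₀ h2 (by positivity)]
    nlinarith
  have hsumA : ∑ i : P, 1 / ((pr i : ℝ) * t (pr i)) = ∑ p ∈ P, 1 / ((p : ℝ) * t p) :=
    Finset.sum_coe_sort P fun p => 1 / ((p : ℝ) * t p)
  have hE : ∑ i, ∑ s, (-Real.log (triWeight (w i) s ^ 2)) *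
      rowWeight (pr i) (triWeight (w i)) s ≤ (1 - δ) * Real.log N := by
    refine le_trans (Finset.sum_le_sum fun i _ => sum_entropy_mul_rowWeight_le (hpr i).pos (hw0 i)
      hδ hδ1 (hwδ i) (hx i) (ht _ i.2) (hwt _ i.2)) (le_trans (le_of_eq ?_) hA)
    rw [← Finset.mul_sum, ← hsumA, Finset.mul_sum _ _ α]
    congr 1
    refine Finset.sum_congr rfl fun i _ => ?_
    have := hpp i; have := ht0 i
    simp only [w]
    field_simp
    rfl
  have hlogN : 0 < Real.log N := Real.log_pos (by exact_mod_cast hN)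
  obtain ⟨E, hE1, hE2⟩ := exists_truncated_product pr hpr hinj (fun i => triWeight (w i))
    (fun i s => triWeight_pos (hw0 i) (hw2 i) s) (fun i => sum_triWeight_sq (hw0 i) (hw2 i))
    hlogN hδ hE
  set c : (P → Fin 3) → ℝ := fun e => ∏ i, triWeight (w i) (e i) with hc
  have hc0 : ∀ e, 0 < c e := fun e => Finset.prod_pos fun i _ => triWeight_pos (hw0 i) (hw2 i) _
  have hcsum : ∑ e ∈ E, c e ^ 2 ≤ 1 := by
    calc ∑ e ∈ E, c e ^ 2 ≤ ∑ e, c e ^ 2 :=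
          Finset.sum_le_sum_of_subset_of_nonneg (Finset.subset_univ _) fun e _ _ => sq_nonneg _
      _ = ∏ i, ∑ s, triWeight (w i) s ^ 2 := by
          rw [Fintype.prod_sum]
          exact Finset.sum_congr rfl fun e _ => (Finset.prod_pow _ _ _).symm
      _ = 1 := Finset.prod_eq_one fun i _ => sum_triWeight_sq (hw0 i) (hw2 i)
  have hcE : ∀ e ∈ E, c e ≤ 1 := fun e he => by
    have h1 := (Finset.single_le_sum (f := fun e => c e ^ 2) (fun e _ => sq_nonneg _) he).trans hcsum
    have := hc0 e
    nlinarith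
  have hlow : ∀ e ∈ E, 1 / (N : ℝ) ≤ c e ^ 2 := fun e he => by
    have := hE1 e he
    rwa [Real.exp_neg, Real.exp_log hN0, ← one_div] at this
  have hcN : ∀ e ∈ E, 1 ≤ N * c e := fun e he => by
    have h1 := hlow e he
    have h2 := hcE e he
    have h3 := hc0 e
    rw [div_le_iff₀ hN0] at h1
    nlinarith [mul_le_mul_of_nonneg_left h2 h3.le]
  -- Each kept configuration has probability at least 1/N, and the probabilities sum to at most 1.
  have hEcard : E.card ≤ N := by
    have h1 := Finset.card_nsmul_le_sum E (fun e => c e ^ 2) (1 / N) hlow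
    rw [nsmul_eq_mul, mul_one_div] at h1
    have h2 := h1.trans hcsum
    rw [div_le_one hN0] at h2
    exact_mod_cast h2
  have hcardP : Fintype.card P ≤ X := by
    rw [Fintype.card_coe]
    have : P ⊆ Finset.Icc 1 X := fun p hp => Finset.mem_Icc.2 ⟨(hP p hp).one_le, hX p hp⟩
    simpa using Finset.card_le_card this
  have hprod : Real.exp (4 * (1 - δ) ^ 2 * (Real.sqrt α * ∑ p ∈ P, 1 / (p * t p))) ≤
      ∏ i, ∑ s, rowWeight (pr i) (triWeight (w i)) s := by
    rw [← hsumA, Finset.mul_sum, Finset.mul_sum, Real.exp_sum]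
    refine Finset.prod_le_prod (fun i _ => (Real.exp_pos _).le) fun i _ => ?_
    refine le_trans (le_of_eq ?_) (exp_le_sum_rowWeight (hpr i).pos (hw0 i) hδ hδ1 (hwδ i) (hx i))
    rw [hsw]
    congr 2
    have h1 := hpp i
    have h2 := ht0 i
    have h3 : Real.sqrt (pr i) * Real.sqrt (pr i) = pr i := Real.mul_self_sqrt h1.le
    rw [div_mul_div_comm, mul_one, mul_right_comm, h3, mul_one_div]
  obtain ⟨M, hM, hME, hMd, hMS⟩ := exists_dyadic_galSum_ge (primeProd pr) c E
    (fun e _ => primeProd_pos pr hpr e) (primeProd_injective pr hpr hinj).injOn hc0 hcE hcsum hcN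
    (fun e _ => primeProd_le pr (fun i => hX _ i.2) hX1 hcardP e) (by positivity)
    ((mul_le_mul_of_nonneg_left hprod (sq_nonneg δ)).trans hE2)
  refine ⟨M, hM, fun m hm => ?_, ?_, hMd, ?_, ?_⟩
  · obtain ⟨e, -, rfl⟩ := Finset.mem_image.1 (hME hm)
    exact primeProd_pos pr hpr e
  · exact (Finset.card_le_card hME).trans (Finset.card_image_le.trans hEcard)
  · refine Nat.Coprime.prod_left fun m hm => ?_
    obtain ⟨e, -, rfl⟩ := Finset.mem_image.1 (hME hm)
    exact Nat.Coprime.prod_left fun i _ =>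
      Nat.Coprime.pow_left _ (((hpr i).coprime_iff_not_dvd).2 (hPq _ i.2))
  · rw [Nat.log_pow (by norm_num)] at hMS
    push_cast at hMS
    exact hMS

/-! ### The mass of 1/(p log(p/y)) on primes avoiding q -/

/-- Mertens' theorem summed over blocks of length `H` of the variable `log (p / y)`. -/
theorem exists_log_le_sum_div_log_div (C : ℝ) (hC : 0 < C)
    (hMer : ∀ a b : ℝ, 1 ≤ a → a ≤ b → Real.log (b / a) - C ≤
      ∑ p ∈ (Finset.Ioc ⌊a⌋₊ ⌊b⌋₊).filter Nat.Prime, Real.log p / p)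
    {δ y : ℝ} (hδ : 0 < δ) (hy : 1 ≤ y) {J K : ℕ} (hJK : J ≤ K) :
    (1 - δ) * Real.log ((K + 1) / (J + 1)) ≤
      ∑ p ∈ (Finset.Ioc ⌊y * Real.exp (C / δ * J)⌋₊ ⌊y * Real.exp (C / δ * K)⌋₊).filter Nat.Prime,
        Real.log p / (p * Real.log (p / y)) := by
  -- With this block length the Mertens error C is the fraction δ of a block. The block from H K to
  -- H (K + 1) then contributes at least (1 - δ)/(K + 1), and these add up to a logarithm.
  set H := C / δ with hHd
  have hH : 0 < H := by positivity
  have hHC : H * δ = C := by rw [hHd]; field_simp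
  have hy0 : 0 < y := by linarith
  induction K, hJK using Nat.le_induction with
  | base =>
    rw [div_self (by positivity)]
    simp
  | succ K hJK ih =>
    have hle1 : ⌊y * Real.exp (H * J)⌋₊ ≤ ⌊y * Real.exp (H * K)⌋₊ := by
      have : (J : ℝ) ≤ K := by exact_mod_cast hJK
      gcongr
    have hle2 : ⌊y * Real.exp (H * K)⌋₊ ≤ ⌊y * Real.exp (H * (K + 1 : ℕ))⌋₊ := by
      push_cast
      gcongr
      linarith
    have hsplit : ∀ g : ℕ → ℝ,
        ∑ p ∈ (Finset.Ioc ⌊y * Real.exp (H * J)⌋₊ ⌊y * Real.exp (H * (K + 1 : ℕ))⌋₊).filter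
          Nat.Prime, g p =
        ∑ p ∈ (Finset.Ioc ⌊y * Real.exp (H * J)⌋₊ ⌊y * Real.exp (H * K)⌋₊).filter Nat.Prime, g p +
        ∑ p ∈ (Finset.Ioc ⌊y * Real.exp (H * K)⌋₊ ⌊y * Real.exp (H * (K + 1 : ℕ))⌋₊).filter
          Nat.Prime, g p := by
      intro g
      rw [← Finset.Ioc_union_Ioc_eq_Ioc hle1 hle2, Finset.filter_union, Finset.sum_union]
      refine Finset.disjoint_filter_filter ?_
      rw [Finset.disjoint_left]
      intro p h1 h2
      rw [Finset.mem_Ioc] at h1 h2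
      omega
    rw [hsplit]
    have hM := hMer (y * Real.exp (H * K)) (y * Real.exp (H * (K + 1 : ℕ)))
      (one_le_mul_of_one_le_of_one_le hy (Real.one_le_exp (by positivity))) (by
        push_cast
        gcongr
        linarith)
    rw [mul_div_mul_left _ _ hy0.ne', ← Real.exp_sub, Real.log_exp] at hM
    push_cast at hM ⊢
    have hM2 : H * (1 - δ) ≤ ∑ p ∈ (Finset.Ioc ⌊y * Real.exp (H * K)⌋₊
        ⌊y * Real.exp (H * (K + 1))⌋₊).filter Nat.Prime, Real.log p / p := by linarith
    have hblock : (1 - δ) / (K + 1) ≤ ∑ p ∈ (Finset.Ioc ⌊y * Real.exp (H * K)⌋₊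
        ⌊y * Real.exp (H * (K + 1))⌋₊).filter Nat.Prime,
          Real.log p / (p * Real.log (p / y)) := by
      have h1 : (1 - δ) / (K + 1) = (H * (1 - δ)) * (1 / (H * (K + 1))) := by field_simp
      rw [h1]
      refine (mul_le_mul_of_nonneg_right hM2 (by positivity)).trans ?_
      rw [Finset.sum_mul]
      refine Finset.sum_le_sum fun p hp => ?_
      obtain ⟨hp, hpp⟩ := Finset.mem_filter.1 hp
      rw [Finset.mem_Ioc, Nat.floor_lt (by positivity), Nat.le_floor_iff (by positivity)] at hp
      have hp0 : (0 : ℝ) < p := by exact_mod_cast hpp.pos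
      have hlog : 0 ≤ Real.log p := Real.log_natCast_nonneg p
      have ht1 : 0 < Real.log (p / y) := by
        apply Real.log_pos
        rw [one_lt_div hy0]
        refine lt_of_le_of_lt ?_ hp.1
        exact le_mul_of_one_le_right hy0.le (Real.one_le_exp (by positivity))
      have ht2 : Real.log (p / y) ≤ H * (K + 1) := by
        rw [Real.log_le_iff_le_exp (by positivity), div_le_iff₀ hy0]
        linarith [hp.2]
      rw [div_mul_div_comm, mul_one]
      exact div_le_div_of_nonneg_left hlog (by positivity) (by gcongr)
    have hlogstep : Real.log ((K + 1 + 1) / (J + 1)) ≤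
        Real.log ((K + 1) / (J + 1)) + 1 / (K + 1) := by
      have h1 : ((K : ℝ) + 1 + 1) / (J + 1) = (K + 1) / (J + 1) * (1 + 1 / (K + 1)) := by
        field_simp
      rw [h1, Real.log_mul (by positivity) (by positivity)]
      have := Real.log_le_sub_one_of_pos (show (0 : ℝ) < 1 + 1 / (K + 1) by positivity)
      linarith
    rcases le_or_gt δ 1 with hδ1 | hδ1
    · have := mul_le_mul_of_nonneg_left hlogstep (by linarith : 0 ≤ 1 - δ)
      have e : (1 - δ) * (Real.log ((K + 1) / (J + 1)) + 1 / (K + 1)) =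
        (1 - δ) * Real.log ((K + 1) / (J + 1)) + (1 - δ) / (K + 1) := by ring
      linarith
    · refine le_trans (mul_nonpos_of_nonpos_of_nonneg (by linarith) (Real.log_nonneg ?_)) ?_
      · rw [one_le_div (by positivity)]
        have : (J : ℝ) ≤ K := by exact_mod_cast hJK
        linarith
      · refine add_nonneg (Finset.sum_nonneg fun p hp => ?_) (Finset.sum_nonneg fun p hp => ?_) <;>
        · obtain ⟨hp, hpp⟩ := Finset.mem_filter.1 hp
          rw [Finset.mem_Ioc, Nat.floor_lt (by positivity)] at hp
          have hp0 : (0 : ℝ) < p := by exact_mod_cast hpp.pos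
          have h1 : 1 ≤ (p : ℝ) / y := by
            rw [one_le_div hy0]
            exact (le_mul_of_one_le_right hy0.le (Real.one_le_exp (by positivity))).trans hp.1.le
          exact div_nonneg (Real.log_natCast_nonneg p) (mul_nonneg hp0.le (Real.log_nonneg h1))

/-- Few excluded primes cost little. -/
theorem sum_not_dvd_ge {y T : ℝ} (hy : 0 < y) (hT : 1 ≤ T) {q : ℕ} (hq : q ≠ 0)
    (hω : (ArithmeticFunction.cardDistinctFactors q : ℝ) ≤ y) (n : ℕ) :
    ∑ p ∈ (Finset.Ioc ⌊y * Real.exp T⌋₊ n).filter Nat.Prime, 1 / (p * Real.log (p / y)) -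
      Real.exp (-T) ≤
    ∑ p ∈ ((Finset.Ioc ⌊y * Real.exp T⌋₊ n).filter Nat.Prime).filter (¬ · ∣ q),
      1 / (p * Real.log (p / y)) := by
  rw [← Finset.sum_filter_add_sum_filter_not ((Finset.Ioc ⌊y * Real.exp T⌋₊ n).filter Nat.Prime)
    (· ∣ q)]
  have h1 : ∑ p ∈ ((Finset.Ioc ⌊y * Real.exp T⌋₊ n).filter Nat.Prime).filter (· ∣ q),
      1 / (p * Real.log (p / y)) ≤ Real.exp (-T) := by
    have hb : ∀ p ∈ ((Finset.Ioc ⌊y * Real.exp T⌋₊ n).filter Nat.Prime).filter (· ∣ q),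
        1 / (p * Real.log (p / y)) ≤ 1 / (y * Real.exp T) := by
      intro p hp
      simp only [Finset.mem_filter, Finset.mem_Ioc] at hp
      have hp1 := (Nat.floor_lt (by positivity)).1 hp.1.1.1
      have hp0 : (0 : ℝ) < p := lt_of_le_of_lt (by positivity) hp1
      have ht : T ≤ Real.log (p / y) := by
        rw [Real.le_log_iff_exp_le (by positivity), le_div_iff₀ hy]
        linarith
      refine one_div_le_one_div_of_le (by positivity) (hp1.le.trans ?_)
      exact le_mul_of_one_le_right hp0.le (hT.trans ht)
    have h2 := Finset.sum_le_card_nsmul _ _ _ hb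
    have hcard : ((((Finset.Ioc ⌊y * Real.exp T⌋₊ n).filter Nat.Prime).filter (· ∣ q)).card : ℝ) ≤
        y := by
      refine le_trans ?_ hω
      rw [ArithmeticFunction.cardDistinctFactors_apply, ← List.card_toFinset]
      exact_mod_cast Finset.card_le_card fun p hp => by
        simp only [Finset.mem_filter, Finset.mem_Ioc] at hp
        exact Nat.mem_primeFactors.2 ⟨hp.1.2, hp.2, hq⟩
    rw [nsmul_eq_mul] at h2
    refine h2.trans ((mul_le_mul_of_nonneg_right hcard (by positivity)).trans (le_of_eq ?_))
    rw [Real.exp_neg]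
    field_simp
  linarith

theorem primePi_le {x : ℝ} (hx : 0 ≤ x) : (primePi x : ℝ) ≤ x := by
  refine le_trans ?_ (Nat.floor_le hx)
  unfold primePi
  rw [← Nat.primesLE_card_eq_primeCounting]
  have h : Nat.primesLE ⌊x⌋₊ ⊆ Finset.Icc 1 ⌊x⌋₊ := fun p hp =>
    Finset.mem_Icc.2 ⟨(Nat.mem_primesLE.1 hp).2.one_le, (Nat.mem_primesLE.1 hp).1⟩
  exact_mod_cast (Finset.card_le_card h).trans (by simp)

theorem eventually_log_le_mul_rpow {a c : ℝ} (ha : 0 < a) (hc : 0 < c) :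
    ∀ᶠ l : ℝ in atTop, Real.log l ≤ c * l ^ a := by
  filter_upwards [(isLittleO_log_rpow_atTop ha).bound hc, eventually_ge_atTop 1] with l h h1
  have h2 : 0 ≤ Real.log l := Real.log_nonneg h1
  have h3 : 0 ≤ l ^ a := Real.rpow_nonneg (by linarith) _
  rwa [Real.norm_of_nonneg h2, Real.norm_of_nonneg h3] at h

theorem eventually_le_rpow {a : ℝ} (ha : 0 < a) (C : ℝ) : ∀ᶠ l : ℝ in atTop, C ≤ l ^ a :=
  (tendsto_rpow_atTop ha).eventually_ge_atTop C

theorem eventually_le_mul_log {c : ℝ} (hc : 0 < c) (C : ℝ) :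
    ∀ᶠ l : ℝ in atTop, C ≤ c * Real.log l :=
  (Real.tendsto_log_atTop.const_mul_atTop hc).eventually_ge_atTop C

/-- A supply of primes `p`, coprime to `q`, with nearly the full mass of `1 / (p * log (p / y))`,
for `y = l * exp l`. -/
theorem eventually_exists_primes {δ : ℝ} (hδ : 0 < δ) (hδ1 : δ ≤ 1 / 10) :
    ∀ᶠ l : ℝ in atTop, ∀ q : ℕ, q ≠ 0 →
      (ArithmeticFunction.cardDistinctFactors q : ℝ) ≤ Real.exp l * l →
      ∃ P : Finset ℕ, (∀ p ∈ P, p.Prime ∧ ¬ p ∣ q ∧ l ^ δ ≤ Real.log (p / (Real.exp l * l)) ∧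
        Real.log (p / (Real.exp l * l)) ≤ δ * l) ∧
        (1 - 7 * δ) * Real.log l / l ≤ ∑ p ∈ P, 1 / (p * Real.log (p / (Real.exp l * l))) := by
  obtain ⟨C₀, hC₀, hMer₀⟩ := exists_le_sum_log_div_prime
  -- Enlarging the constant to at least 1 ensures H ≥ 1, so the first block starts at H J ≥ l ^ δ.
  set C := max C₀ 1 with hC
  have hC1 : 1 ≤ C := le_max_right _ _
  have hMer : ∀ a b : ℝ, 1 ≤ a → a ≤ b → Real.log (b / a) - C ≤
      ∑ p ∈ (Finset.Ioc ⌊a⌋₊ ⌊b⌋₊).filter Nat.Prime, Real.log p / p := fun a b ha hab =>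
    le_trans (by linarith [le_max_left C₀ 1]) (hMer₀ a b ha hab)
  set H := C / δ with hH
  have hH1 : 1 ≤ H := by rw [hH, one_le_div hδ]; linarith
  filter_upwards [eventually_ge_atTop 1, eventually_log_le_mul_rpow one_pos hδ,
    eventually_le_rpow hδ (H / δ), eventually_le_rpow (show 0 < 1 - 2 * δ by linarith) 3,
    eventually_log_le_mul_rpow hδ one_pos, eventually_le_mul_log hδ (Real.log 3),
    eventually_le_mul_log hδ 1] with l hl hlog hHl h3 hlδ hlog3 hlog1
  intro q hq hω
  rw [Real.rpow_one] at hlog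
  rw [one_mul] at hlδ
  have hl0 : 0 < l := by linarith
  have hd0 : 0 < l ^ δ := Real.rpow_pos_of_pos hl0 _
  have hd1 : 1 ≤ l ^ δ := Real.one_le_rpow hl hδ.le
  have e1 : l ^ (1 - 2 * δ) * l ^ δ = l ^ (1 - δ) := by
    rw [← Real.rpow_add hl0]; ring_nf
  have e2 : l ^ (1 - δ) * l ^ δ = l := by
    rw [← Real.rpow_add hl0]; simp
  have hlarge : 3 * l ^ δ ≤ l ^ (1 - δ) := by rw [← e1]; gcongr
  set y := Real.exp l * l with hy
  have hexp : 1 ≤ Real.exp l := Real.one_le_exp hl0.le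
  have hy1 : 1 ≤ y := one_le_mul_of_one_le_of_one_le hexp hl
  have hy0 : 0 < y := by linarith
  have hlogy : Real.log y = l + Real.log l := by
    rw [hy, Real.log_mul (by positivity) hl0.ne', Real.log_exp]
  -- The range of log(p/y) runs from about l ^ δ to about l ^ (1 - δ), up to the constant H. It is
  -- long enough to give (1 - O(δ)) log l, and short enough that log p ≤ (1 + 2δ) l throughout.
  set J := ⌈l ^ δ⌉₊ with hJ
  set K := ⌊l ^ (1 - δ)⌋₊ with hK
  have hJ1 : l ^ δ ≤ J := Nat.le_ceil _
  have hJ2 : (J : ℝ) < l ^ δ + 1 := Nat.ceil_lt_add_one hd0.le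
  have hK1 : (K : ℝ) ≤ l ^ (1 - δ) := Nat.floor_le (by linarith)
  have hK2 : l ^ (1 - δ) < K + 1 := Nat.lt_floor_add_one _
  have hJK : J ≤ K := by
    have : (J : ℝ) < K + 1 := by linarith
    have : J < K + 1 := by exact_mod_cast this
    omega
  have hT0 : l ^ δ ≤ H * J := by nlinarith
  have hT1 : H * K ≤ δ * l := by
    have h1 : H ≤ δ * l ^ δ := by rw [div_le_iff₀ hδ] at hHl; linarith
    calc H * K ≤ (δ * l ^ δ) * l ^ (1 - δ) :=
          mul_le_mul h1 hK1 (Nat.cast_nonneg _) (by positivity)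
      _ = δ * (l ^ (1 - δ) * l ^ δ) := by ring
      _ = δ * l := by rw [e2]
  have hlogl : 0 < Real.log l := by
    by_contra h
    nlinarith
  set P₀ := (Finset.Ioc ⌊y * Real.exp (H * J)⌋₊ ⌊y * Real.exp (H * K)⌋₊).filter Nat.Prime with hP₀
  have hP : ∀ p ∈ P₀, p.Prime ∧ l ^ δ ≤ Real.log (p / y) ∧ Real.log (p / y) ≤ δ * l := by
    intro p hp
    obtain ⟨hp, hpp⟩ := Finset.mem_filter.1 hp
    rw [Finset.mem_Ioc, Nat.floor_lt (by positivity), Nat.le_floor_iff (by positivity)] at hp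
    have hp0 : (0 : ℝ) < p := by exact_mod_cast hpp.pos
    refine ⟨hpp, ?_, ?_⟩
    · refine hT0.trans ?_
      rw [Real.le_log_iff_exp_le (by positivity), le_div_iff₀ hy0]
      linarith [hp.1]
    · refine le_trans ?_ hT1
      rw [Real.log_le_iff_le_exp (by positivity), div_le_iff₀ hy0]
      linarith [hp.2]
  refine ⟨P₀.filter (¬ · ∣ q), fun p hp => ?_, ?_⟩
  · obtain ⟨hp, hpq⟩ := Finset.mem_filter.1 hp
    exact ⟨(hP p hp).1, hpq, (hP p hp).2⟩
  have hB := exists_log_le_sum_div_log_div C (by linarith) hMer hδ hy1 hJK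
  have hR := sum_not_dvd_ge hy0 (hd1.trans hT0) hq hω ⌊y * Real.exp (H * K)⌋₊
  have hratio : (1 - 3 * δ) * Real.log l ≤ Real.log ((K + 1) / (J + 1)) := by
    have h1 : l ^ (1 - 2 * δ) / 3 ≤ (K + 1) / (J + 1) := by
      rw [div_le_div_iff₀ (by norm_num) (by positivity)]
      have h2 : (J : ℝ) + 1 ≤ 3 * l ^ δ := by linarith
      have h3 : 0 ≤ l ^ (1 - 2 * δ) := by positivity
      nlinarith [mul_le_mul_of_nonneg_left h2 h3]
    refine le_trans ?_ (Real.log_le_log (by positivity) h1)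
    rw [Real.log_div (by positivity) (by norm_num), Real.log_rpow hl0]
    linarith
  have hmass : (1 - 6 * δ) * Real.log l / l ≤ ∑ p ∈ P₀, 1 / (p * Real.log (p / y)) := by
    have h1 : (1 - δ) * ((1 - 3 * δ) * Real.log l) ≤
        ∑ p ∈ P₀, Real.log p / (p * Real.log (p / y)) :=
      (mul_le_mul_of_nonneg_left hratio (by linarith)).trans hB
    have h2 : ∑ p ∈ P₀, Real.log p / (p * Real.log (p / y)) ≤
        ((1 + 2 * δ) * l) * ∑ p ∈ P₀, 1 / (p * Real.log (p / y)) := by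
      rw [Finset.mul_sum]
      refine Finset.sum_le_sum fun p hp => ?_
      obtain ⟨hpp, ht1, ht2⟩ := hP p hp
      have hp0 : (0 : ℝ) < p := by exact_mod_cast hpp.pos
      have ht0 : 0 < Real.log (p / y) := by linarith
      rw [mul_one_div]
      gcongr
      rw [Real.log_div hp0.ne' hy0.ne', hlogy] at ht2
      linarith
    rw [div_le_iff₀ hl0]
    set A := ∑ p ∈ P₀, 1 / (p * Real.log (p / y))
    have h3 : (1 - 6 * δ) * (1 + 2 * δ) * Real.log l ≤ (1 + 2 * δ) * (A * l) := by
      have h4 : (1 - 6 * δ) * (1 + 2 * δ) * Real.log l ≤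
          (1 - δ) * ((1 - 3 * δ) * Real.log l) := by
        rw [← mul_assoc]
        exact mul_le_mul_of_nonneg_right (by nlinarith) hlogl.le
      linarith
    have h5 : 0 < 1 + 2 * δ := by linarith
    refine le_of_mul_le_mul_left ?_ h5
    linarith
  have hexpT : Real.exp (-(H * J)) ≤ δ * Real.log l / l := by
    have h1 : Real.exp (-(H * J)) ≤ Real.exp (-Real.log l) := Real.exp_le_exp.2 (by linarith)
    rw [Real.exp_neg (Real.log l), Real.exp_log hl0] at h1
    refine h1.trans ?_
    rw [inv_eq_one_div]
    gcongr
  have e3 : (1 - 7 * δ) * Real.log l / l = (1 - 6 * δ) * Real.log l / l - δ * Real.log l / l := by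
    ring
  linarith

/-! ### Choice of parameters -/

theorem sum_one_div_le (P : Finset ℕ) (X : ℕ) (hP : ∀ p ∈ P, 1 ≤ p ∧ p ≤ X) :
    ∑ p ∈ P, 1 / (p : ℝ) ≤ 1 + Real.log X := by
  refine le_trans (Finset.sum_le_sum_of_subset_of_nonneg (t := Finset.Icc 1 X)
    (fun p hp => Finset.mem_Icc.2 (hP p hp)) fun _ _ _ => by positivity) ?_
  refine le_trans (le_of_eq ?_) (harmonic_le_one_add_log X)
  rw [harmonic_eq_sum_Icc]
  push_cast
  exact Finset.sum_congr rfl fun _ _ => one_div _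

/-- The number of classes is at most a power of log N = exp l, which exp(δ Z) will absorb. -/
theorem class_count_le {δ l : ℝ} (hl : 1 ≤ l) (hδ1 : δ ≤ 1) {N : ℕ}
    (hlN : Real.log N = Real.exp l) :
    4 * ((2 * (⌊Real.exp l * l * Real.exp (δ * l)⌋₊ : ℝ) ^ 2 + 1) * ((Nat.log 2 N : ℝ) + 1)) ≤
      36 * Real.exp (7 * l) := by
  have h1 : (⌊Real.exp l * l * Real.exp (δ * l)⌋₊ : ℝ) ≤ Real.exp (3 * l) := by
    refine (Nat.floor_le (by positivity)).trans ?_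
    have e : Real.exp (3 * l) = Real.exp l * Real.exp l * Real.exp l := by
      rw [← Real.exp_add, ← Real.exp_add]; ring_nf
    rw [e]
    have h2 : l ≤ Real.exp l := by linarith [Real.add_one_le_exp l]
    gcongr
    nlinarith
  have h2 : (⌊Real.exp l * l * Real.exp (δ * l)⌋₊ : ℝ) ^ 2 ≤ Real.exp (6 * l) := by
    refine (pow_le_pow_left₀ (Nat.cast_nonneg _) h1 2).trans (le_of_eq ?_)
    rw [← Real.exp_nat_mul]; push_cast; ring_nf
  have h3 : (1 : ℝ) ≤ Real.exp (6 * l) := Real.one_le_exp (by linarith)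
  have h4 : (1 : ℝ) ≤ Real.exp l := Real.one_le_exp (by linarith)
  have h5 : (Nat.log 2 N : ℝ) ≤ 2 * Real.exp l := by
    refine (Real.natLog_le_logb N 2).trans ?_
    rw [Real.logb, hlN, div_le_iff₀ (Real.log_pos (by norm_num))]
    have := Real.log_two_gt_d9
    push_cast
    nlinarith
  have e : Real.exp (7 * l) = Real.exp (6 * l) * Real.exp l := by
    rw [← Real.exp_add]; ring_nf
  have h6 : (2 * (⌊Real.exp l * l * Real.exp (δ * l)⌋₊ : ℝ) ^ 2 + 1) * ((Nat.log 2 N : ℝ) + 1) ≤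
      (3 * Real.exp (6 * l)) * (3 * Real.exp l) :=
    mul_le_mul (by linarith) (by linarith) (by positivity) (by positivity)
  rw [e]
  linarith

/-- After y cancels, the weight is exp(-t) up to powers of t and l. Their logarithms are small
against δ t. -/
theorem neg_log_weight_le {κ A l t δ : ℝ} (hκ : 2 / 5 ≤ κ) (hA0 : 0 < A) (hA : A ≤ 6 * l)
    (hl : 1 ≤ l) (ht : 1 ≤ t) (h1 : Real.log t ≤ δ / 4 * t) (h2 : Real.log l ≤ δ / 8 * t)
    (h3 : 8 * Real.log 12 ≤ δ * t) :
    -Real.log (κ / (2 * (A * l)) / (Real.exp t * t ^ 2)) ≤ (1 + δ) * t := by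
  have hl0 : 0 < l := by linarith
  have hκ0 : 0 < κ := by linarith
  have ht0 : 0 < t := by linarith
  rw [Real.log_div (by positivity) (by positivity), Real.log_mul (by positivity) (by positivity),
    Real.log_exp, Real.log_pow]
  have h5 : -Real.log (κ / (2 * (A * l))) ≤ Real.log 12 + Real.log 12 + 2 * Real.log l := by
    rw [← Real.log_inv, inv_div, ← Real.log_mul (by norm_num) (by norm_num),
      show 2 * Real.log l = Real.log (l ^ 2) by rw [Real.log_pow]; norm_num,
      ← Real.log_mul (by norm_num) (by positivity)]
    apply Real.log_le_log (by positivity)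
    rw [div_le_iff₀ hκ0]
    have h6 : A * l ≤ 6 * l * l := by gcongr
    nlinarith [mul_le_mul_of_nonneg_left hκ (show 0 ≤ l ^ 2 by positivity)]
  push_cast
  linarith

theorem one_sub_mul_sqrt_le {κ A l α δ : ℝ} (hδ1 : δ ≤ 1 / 10) (hκ : 1 - 7 * δ ≤ κ) (hA0 : 0 < A)
    (hα0 : 0 < α) (hl : 0 < l) (hlog : 0 ≤ Real.log l) (hαA : α * A = κ * Real.exp l / 2)
    (hA : (1 - 7 * δ) * Real.log l / l ≤ A) :
    (1 - 7 * δ) * Real.sqrt (Real.exp l * Real.log l / l) ≤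
      Real.sqrt 2 * (Real.sqrt α * A) := by
  have h1 : Real.sqrt 2 * (Real.sqrt α * A) = Real.sqrt (κ * Real.exp l * A) := by
    have : Real.sqrt α * A = Real.sqrt (α * A ^ 2) := by
      rw [Real.sqrt_mul hα0.le, Real.sqrt_sq hA0.le]
    rw [this, ← Real.sqrt_mul (by norm_num)]
    congr 1
    linear_combination 2 * A * hαA
  rw [h1]
  apply Real.le_sqrt_of_sq_le
  rw [mul_pow, Real.sq_sqrt (by positivity)]
  have h2 : (1 - 7 * δ) * (Real.log l / l) ≤ A := by rwa [← mul_div_assoc]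
  have h3 : 0 ≤ Real.log l / l := by positivity
  have hκ0 : 0 ≤ κ := by linarith
  calc (1 - 7 * δ) ^ 2 * (Real.exp l * Real.log l / l)
      = ((1 - 7 * δ) * Real.exp l) * ((1 - 7 * δ) * (Real.log l / l)) := by ring
    _ ≤ (κ * Real.exp l) * A := by
        apply mul_le_mul _ h2 (mul_nonneg (by linarith) h3) (by positivity)
        gcongr

theorem exponent_le {δ Z S : ℝ} (hδ : 0 < δ) (hδ1 : δ ≤ 1 / 10) (hZ : 0 ≤ Z)
    (h : (1 - 7 * δ) * Z ≤ Real.sqrt 2 * S) :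
    Z * (2 * Real.sqrt 2 - 27 * δ) + δ * Z ≤ 4 * (1 - δ) ^ 2 * S := by
  have hs2 : Real.sqrt 2 * Real.sqrt 2 = 2 := Real.mul_self_sqrt (by norm_num)
  have hs0 : 0 < Real.sqrt 2 := by positivity
  have hs1 : Real.sqrt 2 ≤ 1.42 := by
    rw [Real.sqrt_le_left (by norm_num)]; norm_num
  have h1 : 4 * (1 - δ) ^ 2 * S = (2 * Real.sqrt 2 * (1 - δ) ^ 2) * (Real.sqrt 2 * S) := by
    linear_combination (-2 * (1 - δ) ^ 2 * S) * hs2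
  rw [h1]
  refine le_trans ?_ (mul_le_mul_of_nonneg_left h (by positivity))
  have h2 : 1 - 9 * δ ≤ (1 - δ) ^ 2 * (1 - 7 * δ) := by nlinarith [pow_pos hδ 2, pow_pos hδ 3]
  have h3 : 2 * Real.sqrt 2 - 26 * δ ≤ 2 * Real.sqrt 2 * ((1 - δ) ^ 2 * (1 - 7 * δ)) := by
    refine le_trans ?_ (mul_le_mul_of_nonneg_left h2 (by positivity))
    nlinarith
  have h4 := mul_le_mul_of_nonneg_left h3 hZ
  linarith

set_option maxHeartbeats 1000000 in
/-- The main lower bound, with exponents short of `2 * √2` by a multiple of `δ`. -/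
theorem eventually_exists_galSum_ge {δ : ℝ} (hδ : 0 < δ) (hδ1 : δ ≤ 1 / 10) :
    ∀ᶠ N : ℕ in atTop, ∀ q : ℕ, 1 ≤ q →
      ArithmeticFunction.cardDistinctFactors q
          ≤ primePi (Real.log (N : ℝ) * Real.log (Real.log (N : ℝ))) →
      ∃ (M : Finset ℕ) (hM : M.Nonempty), (∀ m ∈ M, 0 < m) ∧ M.card ≤ N ∧
        M.max' hM ≤ 2 * M.min' hM ∧ Nat.Coprime (∏ m ∈ M, m) q ∧
        (M.card : ℝ) * galL N ^ (2 * Real.sqrt 2 - 27 * δ) ≤ galSum M := by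
  have hloglog : Tendsto (fun N : ℕ => Real.log (Real.log (N : ℝ))) atTop atTop :=
    Real.tendsto_log_atTop.comp (Real.tendsto_log_atTop.comp tendsto_natCast_atTop_atTop)
  obtain ⟨t₀, ht₀⟩ := eventually_atTop.1
    (eventually_log_le_mul_rpow one_pos (show 0 < δ / 4 by positivity))
  -- This serves twice: for t² ≤ δ² α, and for 8 l ≤ δ Z when the class count is absorbed.
  have hcube : ∀ᶠ l : ℝ in atTop, 64 / δ ^ 2 ≤ Real.exp l / l ^ 3 :=
    (Real.tendsto_exp_div_pow_atTop 3).eventually_ge_atTop _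
  have hev := hloglog.eventually ((eventually_exists_primes hδ hδ1).and
    ((eventually_ge_atTop 1).and ((eventually_le_rpow hδ (6 / δ)).and
    ((eventually_le_rpow hδ t₀).and
    ((eventually_log_le_mul_rpow hδ (show 0 < δ / 8 by positivity)).and
    ((eventually_le_rpow hδ (8 * Real.log 12 / δ)).and (hcube.and
    ((Real.tendsto_log_atTop.eventually_ge_atTop 4).and
    (eventually_ge_atTop (Real.log (36 / δ ^ 2)))))))))))
  filter_upwards [hev, eventually_ge_atTop 3] with N hN hN3
  obtain ⟨hprimes, hl, h6, hlt₀, hlog8, hlog12, hcube, hlog4, hK⟩ := hN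
  intro q hq hω
  set l := Real.log (Real.log (N : ℝ)) with hldef
  have hlogN : 0 < Real.log N := Real.log_pos (by exact_mod_cast (by omega : 1 < N))
  have hlN : Real.log N = Real.exp l := (Real.exp_log hlogN).symm
  have hl0 : 0 < l := by linarith
  rw [hlN] at hω
  obtain ⟨P, hP, hA⟩ := hprimes q (by omega) (le_trans (by exact_mod_cast hω)
    (primePi_le (by positivity)))
  set y := Real.exp l * l with hy
  have hy0 : 0 < y := by positivity
  set A := ∑ p ∈ P, 1 / ((p : ℝ) * Real.log (p / y)) with hAdef
  set Z := Real.sqrt (Real.exp l * Real.log l / l) with hZ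
  have hgal : galL N = Real.exp Z := by
    rw [galL, ← hldef, hlN]
  have hloglpos : 0 < Real.log l := by linarith
  have hlδ : 1 ≤ l ^ δ := Real.one_le_rpow hl hδ.le
  have hA1 : 1 / l ≤ A := by
    refine le_trans ?_ hA
    gcongr
    nlinarith
  have hA0 : 0 < A := lt_of_lt_of_le (by positivity) hA1
  have hAl : 1 ≤ A * l := by rwa [div_le_iff₀ hl0] at hA1
  set X := ⌊y * Real.exp (δ * l)⌋₊ with hXdef
  have hp0 : ∀ p ∈ P, (0 : ℝ) < p := fun p hp => by exact_mod_cast (hP p hp).1.pos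
  have hpy : ∀ p ∈ P, (p : ℝ) = y * Real.exp (Real.log (p / y)) := fun p hp => by
    have := hp0 p hp
    rw [Real.exp_log (by positivity)]
    field_simp
  have hX : ∀ p ∈ P, p ≤ X := fun p hp => by
    rw [hXdef, Nat.le_floor_iff (by positivity), hpy p hp]
    have := (hP p hp).2.2.2
    gcongr
  have ht1 : ∀ p ∈ P, 1 ≤ Real.log (p / y) := fun p hp => hlδ.trans (hP p hp).2.2.1
  have hX1 : 1 ≤ X := by
    rw [hXdef, Nat.one_le_floor_iff]
    exact one_le_mul_of_one_le_of_one_le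
      (one_le_mul_of_one_le_of_one_le (Real.one_le_exp hl0.le) hl) (Real.one_le_exp (by positivity))
  -- The true size of A is far smaller; this crude bound suffices to keep α large and log(1/w) close
  -- to t.
  have hA3 : A ≤ 6 * l := by
    have h1 : A ≤ ∑ p ∈ P, 1 / (p : ℝ) := by
      refine Finset.sum_le_sum fun p hp => ?_
      have := hp0 p hp
      exact one_div_le_one_div_of_le this (le_mul_of_one_le_right this.le (ht1 p hp))
    have h2 := sum_one_div_le P X fun p hp => ⟨(hP p hp).1.one_le, hX p hp⟩
    have h3 : Real.log X ≤ l + Real.log l + δ * l := by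
      have h4 : (X : ℝ) ≤ y * Real.exp (δ * l) := Nat.floor_le (by positivity)
      refine (Real.log_le_log (by exact_mod_cast hX1) h4).trans (le_of_eq ?_)
      rw [Real.log_mul (by positivity) (by positivity), hy,
        Real.log_mul (by positivity) (by positivity), Real.log_exp, Real.log_exp]
    have h4 : Real.log l ≤ l := (Real.log_le_sub_one_of_pos hl0).trans (by linarith)
    have h5 : δ * l ≤ l := by nlinarith
    linarith
  -- Chosen so that (1 + 5δ) κ ≤ 1 - δ, which is what the information budget requires; α then uses
  -- up that budget.
  set κ := 1 - 6 * δ with hκ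
  have hκ0 : 2 / 5 ≤ κ := by linarith
  have hκ1 : κ ≤ 1 := by linarith
  set α := κ * Real.exp l / (2 * A) with hα
  have hα0 : 0 < α := by positivity
  have hαA : α * A = κ * Real.exp l / 2 := by rw [hα]; field_simp
  have hαl : Real.exp l / (30 * l) ≤ α := by
    rw [hα, div_le_div_iff₀ (by positivity) (by positivity)]
    have h1 : 2 * A ≤ κ * (30 * l) := by nlinarith
    calc Real.exp l * (2 * A) ≤ Real.exp l * (κ * (30 * l)) := by gcongr
      _ = _ := by ring
  have hcube' : 64 * l ^ 3 ≤ δ ^ 2 * Real.exp l := by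
    rw [div_le_div_iff₀ (by positivity) (by positivity)] at hcube
    linarith
  have hwp : ∀ p ∈ P, α / (p * Real.log (p / y) ^ 2) =
      κ / (2 * (A * l)) / (Real.exp (Real.log (p / y)) * Real.log (p / y) ^ 2) := fun p hp => by
    have h1 := ht1 p hp
    have h2 : Real.log (p / y) ≠ 0 := by linarith
    rw [hα]
    nth_rewrite 1 [hpy p hp]
    rw [hy]
    field_simp
  have hκA : κ / (2 * (A * l)) ≤ 1 := by
    rw [div_le_one (by positivity)]
    linarith
  have h6' : 6 ≤ δ * l ^ δ := by rw [div_le_iff₀ hδ] at h6; linarith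
  obtain ⟨M, hM, hM1, hM2, hM3, hM4, hM5⟩ := exists_galSum_ge P (fun p => Real.log (p / y))
    (q := q) (N := N) (X := X) (α := α) (δ := δ) (by omega) hδ (by linarith) hα0
    (fun p hp => (hP p hp).1) (fun p hp => (hP p hp).2.1) hX hX1
    (fun p hp => h6'.trans (mul_le_mul_of_nonneg_left (hP p hp).2.2.1 hδ.le))
    (fun p hp => by
      have h1 := ht1 p hp
      have h2 := h6'.trans (mul_le_mul_of_nonneg_left (hP p hp).2.2.1 hδ.le)
      have h3 : 1 ≤ Real.exp (Real.log (p / y)) := Real.one_le_exp (by linarith)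
      rw [hwp p hp, div_le_iff₀ (by positivity)]
      refine hκA.trans ?_
      set t := Real.log (p / y)
      have h4 : t ≤ Real.exp t * t ^ 2 := by nlinarith
      have h5 := mul_le_mul_of_nonneg_left h4 (show 0 ≤ δ / 4 by positivity)
      linarith)
    (fun p hp => by
      have h1 := ht1 p hp
      have h3 := (hP p hp).2.2.1
      have h4 := ht₀ _ (hlt₀.trans h3)
      rw [Real.rpow_one] at h4
      have h5 := mul_le_mul_of_nonneg_left h3 hδ.le
      have h6 : 8 * Real.log 12 ≤ δ * l ^ δ := by
        rw [div_le_iff₀ hδ] at hlog12; linarith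
      rw [hwp p hp]
      exact neg_log_weight_le hκ0 hA0 hA3 hl h1 h4 (by linarith) (h6.trans h5))
    (fun p hp => by
      have h1 := ht1 p hp
      have h2 : Real.log (p / y) ≤ l := (hP p hp).2.2.2.trans (by nlinarith)
      refine (pow_le_pow_left₀ (by linarith) h2 2).trans ?_
      refine le_trans ?_ (mul_le_mul_of_nonneg_left hαl (by positivity))
      rw [mul_div_assoc', le_div_iff₀ (by positivity)]
      have : 0 < l ^ 3 := by positivity
      nlinarith)
    (by
      rw [← hAdef, hαA, hlN]
      have : (1 + 5 * δ) * κ ≤ 1 - δ := by rw [hκ]; nlinarith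
      nlinarith [Real.exp_pos l])
  refine ⟨M, hM, hM1, hM2, hM3, hM4, le_trans ?_ hM5⟩
  refine mul_le_mul_of_nonneg_left ?_ (Nat.cast_nonneg _)
  rw [hgal, ← Real.exp_mul, ← hAdef]
  have hZ2 : Z ^ 2 = Real.exp l * Real.log l / l := Real.sq_sqrt (by positivity)
  have hZ0 : 0 ≤ Z := Real.sqrt_nonneg _
  have hmain : (1 - 7 * δ) * Z ≤ Real.sqrt 2 * (Real.sqrt α * A) :=
    one_sub_mul_sqrt_le hδ1 (by linarith) hA0 hα0 hl0 hloglpos.le hαA hA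
  have h8 : 8 * l ≤ δ * Z := by
    refine (sq_le_sq₀ (by positivity) (by positivity)).1 ?_
    rw [mul_pow δ, hZ2, mul_div_assoc', le_div_iff₀ hl0]
    have h1 : δ ^ 2 * Real.exp l * 1 ≤ δ ^ 2 * Real.exp l * Real.log l := by gcongr; linarith
    nlinarith
  have hD := class_count_le (δ := δ) hl (by linarith) hlN
  rw [← hy, ← hXdef] at hD
  have hD2 : 36 * Real.exp (7 * l) ≤ δ ^ 2 * Real.exp (δ * Z) := by
    have h1 : 36 / δ ^ 2 ≤ Real.exp l := (Real.log_le_iff_le_exp (by positivity)).1 hK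
    rw [div_le_iff₀ (by positivity)] at h1
    have h2 : Real.exp (8 * l) ≤ Real.exp (δ * Z) := Real.exp_le_exp.2 h8
    have e : Real.exp (8 * l) = Real.exp l * Real.exp (7 * l) := by
      rw [← Real.exp_add]; ring_nf
    calc 36 * Real.exp (7 * l) ≤ Real.exp l * δ ^ 2 * Real.exp (7 * l) := by gcongr
      _ = δ ^ 2 * Real.exp (8 * l) := by rw [e]; ring
      _ ≤ _ := by gcongr
  rw [le_div_iff₀ (by positivity)]
  have hfin := exponent_le hδ hδ1 hZ0 hmain
  calc Real.exp (Z * (2 * Real.sqrt 2 - 27 * δ)) * (4 * ((2 * (X : ℝ) ^ 2 + 1) *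
        ((Nat.log 2 N : ℝ) + 1)))
      ≤ Real.exp (Z * (2 * Real.sqrt 2 - 27 * δ)) * (δ ^ 2 * Real.exp (δ * Z)) :=
        mul_le_mul_of_nonneg_left (hD.trans hD2) (Real.exp_pos _).le
    _ = δ ^ 2 * Real.exp (Z * (2 * Real.sqrt 2 - 27 * δ) + δ * Z) := by
        rw [Real.exp_add]; ring
    _ ≤ _ := by gcongr

/-! ### Letting the loss tend to zero -/

/-- If `Q N` holds at a fixed `B ≥ 0`, and at each `η > 0` for large `N`, then it holds along a
sequence tending to zero. -/
theorem exists_tendsto_zero_of_eventually (Q : ℕ → ℝ → Prop) {B : ℝ} (hB : 0 ≤ B)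
    (hQB : ∀ N, Q N B) (hQ : ∀ η : ℝ, 0 < η → ∀ᶠ N : ℕ in atTop, Q N η) :
    ∃ e : ℕ → ℝ, Tendsto e atTop (𝓝 0) ∧ ∀ N, Q N (e N) := by
  have hne : ∀ N, ∃ x, 0 ≤ x ∧ Q N x := fun N => ⟨B, hB, hQB N⟩
  -- The infimum of the admissible losses need not be attained, so a slack 1/(N + 1) is allowed.
  have hex : ∀ N : ℕ, ∃ x, (0 ≤ x ∧ Q N x) ∧ x < sInf {x | 0 ≤ x ∧ Q N x} + 1 / ((N : ℝ) + 1) := by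
    intro N
    obtain ⟨x, hx, hlt⟩ := exists_lt_of_csInf_lt (s := {x | 0 ≤ x ∧ Q N x}) (hne N)
      (lt_add_of_pos_right _ (by positivity : (0 : ℝ) < 1 / ((N : ℝ) + 1)))
    exact ⟨x, hx, hlt⟩
  choose e he hlt using hex
  refine ⟨e, ?_, fun N => (he N).2⟩
  rw [Metric.tendsto_nhds]
  intro η hη
  have h1 : ∀ᶠ N : ℕ in atTop, 1 / ((N : ℝ) + 1) < η / 2 :=
    (tendsto_one_div_add_atTop_nhds_zero_nat (𝕜 := ℝ)).eventually_lt_const (by positivity)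
  filter_upwards [h1, hQ (η / 2) (by positivity)] with N h1 h2
  have h3 : sInf {x | 0 ≤ x ∧ Q N x} ≤ η / 2 :=
    csInf_le ⟨0, fun x hx => hx.1⟩ ⟨by positivity, h2⟩
  rw [Real.dist_eq, sub_zero, abs_of_nonneg (he N).1]
  linarith [hlt N]

theorem mainTheorem8 :
    ∃ ε : ℕ → ℝ, Tendsto ε atTop (𝓝 0) ∧
      ∀ q N : ℕ, 1 ≤ q → 3 ≤ N →
        ArithmeticFunction.cardDistinctFactors q
            ≤ primePi (Real.log (N : ℝ) * Real.log (Real.log (N : ℝ))) →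
        ∃ (M : Finset ℕ) (hM : M.Nonempty),
          (∀ m ∈ M, 0 < m) ∧
          M.card ≤ N ∧
          M.max' hM ≤ 2 * M.min' hM ∧
          Nat.Coprime (∏ m ∈ M, m) q ∧
          (16 < N →
            (M.card : ℝ) * galL (N : ℝ) ^ (2 * Real.sqrt 2 + ε N) ≤ galSum M) := by
  obtain ⟨e, he0, he⟩ := exists_tendsto_zero_of_eventually (fun N η => ∀ q : ℕ, 1 ≤ q → 3 ≤ N →
      ArithmeticFunction.cardDistinctFactors q
          ≤ primePi (Real.log (N : ℝ) * Real.log (Real.log (N : ℝ))) →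
      ∃ (M : Finset ℕ) (hM : M.Nonempty), (∀ m ∈ M, 0 < m) ∧ M.card ≤ N ∧
        M.max' hM ≤ 2 * M.min' hM ∧ Nat.Coprime (∏ m ∈ M, m) q ∧
        (M.card : ℝ) * galL N ^ (2 * Real.sqrt 2 - η) ≤ galSum M)
    (B := 2 * Real.sqrt 2) (by positivity)
    -- The loss 2√2 makes the exponent zero, so the set {1} works for every N and q.
    (fun N q _ hN _ => ⟨{1}, Finset.singleton_nonempty 1, by simp, by simp; omega, by simp,
      by simp, by simp [galSum]⟩)
    (fun η hη => by
      have hδ : 0 < min (η / 27) (1 / 10) := by positivity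
      filter_upwards [eventually_exists_galSum_ge hδ (min_le_right _ _)] with N h q hq _ hω
      obtain ⟨M, hM, h1, h2, h3, h4, h5⟩ := h q hq hω
      refine ⟨M, hM, h1, h2, h3, h4, le_trans ?_ h5⟩
      have hL : 1 ≤ galL N := Real.one_le_exp (Real.sqrt_nonneg _)
      have := min_le_left (η / 27) (1 / 10)
      gcongr
      linarith)
  refine ⟨fun N => -e N, by simpa using he0.neg, fun q N hq hN hω => ?_⟩
  obtain ⟨M, hM, h1, h2, h3, h4, h5⟩ := he N q hq hN hω
  refine ⟨M, hM, h1, h2, h3, h4, fun _ => ?_⟩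
  rwa [← sub_eq_add_neg]
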